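/- Let $G$ be a finite group and let $Q$ be a subgroup of $G$ of prime-power order. Then $Q$ is submodular in $G$ if and only if $Q$ is $\mathrm{K}\mathfrak{U}_1$-subnormal in $G$. Here a subgroup $M$ of a group $X$ is \emph{modular} in $X$ if it is a modular element of the subgroup lattice of $X$, i.e. $\langle A, M\cap C\rangle=\langle A,M\rangle\cap C$ for all subgroups $A\le C$ of $X$, and $\langle M, B\cap C\rangle=\langle M,B\rangle\cap C$ for all subgroups $B, C$ of $X$ with $M\le C$. A subgroup $H$ is \emph{submodular} in $G$ if there is a chain of subgroups $H=H_0\le H_1\le\dots\le H_n=G$ such that $H_i$ is modular in $H_{i+1}$ for every $i<n$. Let $\mathfrak{U}_1$ be the class of all finite supersolvable groups of square-free exponent, and for a finite group $X$ let $X^{\mathfrak{U}_1}$ be the intersection of all normal subgroups $N$ of $X$ with $X/N\in\mathfrak{U}_1$. A subgroup $H$ is \emph{$\mathrm{K}\mathfrak{U}_1$-subnormal} in $G$ if there is a chain of subgroups $H=H_0\le H_1\le\dots\le H_n=G$ such that, for every $i<n$, either $H_i$ is normal in $H_{i+1}$ or $H_{i+1}^{\mathfrak{U}_1}\le H_i$.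 -/

import Mathlib

namespace FiniteGroupEmbedding

universe u

/-- An element `m` of a lattice is modular (in the sense of Kurosh) if both modular identities
involving `m` hold: the one with `m` in the middle, and the one with `m` at the bottom. -/
def IsModularElement {α : Type u} [Lattice α] (m : α) : Prop :=
  (∀ x z : α, x ≤ z → x ⊔ (m ⊓ z) = (x ⊔ m) ⊓ z) ∧
    ∀ y z : α, m ≤ z → m ⊔ (y ⊓ z) = (m ⊔ y) ⊓ z

/-- A subgroup is modular if it is a modular element of the lattice of all subgroups. -/
def IsModularSubgroup {G : Type u} [Group G] (M : Subgroup G) : Prop :=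
  IsModularElement M

/-- `Q` is submodular in `G`: there is a chain `Q = H 0 ≤ H 1 ≤ ⋯ ≤ H n = G` of subgroups in which
each `H i` is a modular subgroup of the group `H (i + 1)`. -/
def IsSubmodular {G : Type u} [Group G] (Q : Subgroup G) : Prop :=
  ∃ (n : ℕ) (H : ℕ → Subgroup G), H 0 = Q ∧ H n = ⊤ ∧
    ∀ i < n, H i ≤ H (i + 1) ∧ IsModularSubgroup ((H i).subgroupOf (H (i + 1)))

/-- A class of groups. -/
abbrev GroupClass : Type (u + 1) := (G : Type u) → [Group G] → Prop

/-- The `F`-residual of `G`: the intersection of all normal subgroups with quotient in `F`. -/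
def residual (F : GroupClass.{u}) (G : Type u) [Group G] : Subgroup G :=
  sInf {N : Subgroup G | ∃ _ : N.Normal, F (G ⧸ N)}

/-- `Q` is `KF`-subnormal in `G`: there is a chain `Q = H 0 ≤ H 1 ≤ ⋯ ≤ H n = G` of subgroups such
that, for each `i`, either `H i` is normal in `H (i + 1)` or `H i` contains the `F`-residual of
`H (i + 1)`. -/
def IsKSubnormal (F : GroupClass.{u}) {G : Type u} [Group G] (Q : Subgroup G) : Prop :=
  ∃ (n : ℕ) (H : ℕ → Subgroup G), H 0 = Q ∧ H n = ⊤ ∧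
    ∀ i < n, H i ≤ H (i + 1) ∧
      (((H i).subgroupOf (H (i + 1))).Normal ∨
        residual F (H (i + 1)) ≤ (H i).subgroupOf (H (i + 1)))

/-- `G` is supersolvable: it has a series `1 = N 0 ≤ N 1 ≤ ⋯ ≤ N n = G` of subgroups that are
normal in `G`, with cyclic factors `N (i + 1) / N i`. -/
def IsSupersolvable (G : Type u) [Group G] : Prop :=
  ∃ (n : ℕ) (N : ℕ → Subgroup G) (_ : ∀ i, (N i).Normal), N 0 = ⊥ ∧ N n = ⊤ ∧
    ∀ i < n, N i ≤ N (i + 1) ∧ IsCyclic (N (i + 1) ⧸ (N i).subgroupOf (N (i + 1)))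

/-- The class of all finite supersolvable groups of square-free exponent. -/
def U1 : GroupClass.{u} := fun G _ =>
  Finite G ∧ IsSupersolvable G ∧ Squarefree (Monoid.exponent G)

end FiniteGroupEmbedding

namespace FiniteGroupEmbedding

open Subgroup
open scoped Pointwise

universe v

/-! The prime-power hypothesis serves only the passage from $\mathrm{K}\mathfrak{U}_1$-subnormal to
submodular. Let Q be a q-group and R the residual of X. Square-free exponent of the quotients puts
the q-th power of every element of Q into R, and supersolvability gives a chain of normal subgroups
from R to X with factors of order 1 or a prime. For a factor B/A of order dividing p, Q acts on B/A
through a cyclic group of order dividing q, so QA contains a normal subgroup of QB with index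
dividing pq. The subgroup lattice of a group of such order has length at most 2, hence is modular,
and QA is modular in QB (`modIn_sup_of_card_prime`). Thus QR is submodular in X. Intersecting a
given modular chain from Q with QR joins this to what is already known below
(`modChain_of_isKSubnormal`).

Conversely, let A be a proper modular subgroup of X, and L a maximal proper modular subgroup
containing A. If L is not normal, it is a maximal subgroup of X (`isCoatom_of_maximal_modIn`), and X
modulo the core of L has order pq with primes q < p (`normalOrPrimes_of_isCoatom`). Such a quotient
lies in $\mathfrak{U}_1$, so L contains the residual. As A stays modular in L, induction on the
order finishes.

The hard part is the statement on a maximal modular M that is not normal, by induction with trivial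
core. The intersections of M with its other conjugates are maximal and modular in M, which
determines the order of M. Burnside's transfer theorem for the smallest prime then yields a normal
complement of prime order, on which M acts faithfully. -/

/-- `m` lies below `h` and is a modular element of the interval of elements below `h`. -/
structure ModIn {α : Type*} [Lattice α] (m h : α) : Prop where
  le : m ≤ h
  mid : ∀ x z, x ≤ z → z ≤ h → (x ⊔ m) ⊓ z ≤ x ⊔ (m ⊓ z)
  low : ∀ y z, y ≤ h → z ≤ h → m ≤ z → (m ⊔ y) ⊓ z ≤ m ⊔ (y ⊓ z)

/-! ### Modular elements of lattice intervals. -/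

section Lattice

variable {α : Type*} [Lattice α] {m n h u x y z : α}

lemma ModIn.mid_eq (hm : ModIn m h) (hxz : x ≤ z) (hz : z ≤ h) :
    (x ⊔ m) ⊓ z = x ⊔ (m ⊓ z) :=
  le_antisymm (hm.mid x z hxz hz)
    (sup_le (le_inf le_sup_left hxz) (inf_le_inf_right _ le_sup_right))

lemma ModIn.low_eq (hm : ModIn m h) (hy : y ≤ h) (hz : z ≤ h) (hmz : m ≤ z) :
    (m ⊔ y) ⊓ z = m ⊔ (y ⊓ z) :=
  le_antisymm (hm.low y z hy hz hmz)
    (sup_le (le_inf le_sup_left hmz) (inf_le_inf_right _ le_sup_right))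

lemma isModularElement_iff_modIn [OrderTop α] : IsModularElement m ↔ ModIn m ⊤ :=
  ⟨fun hm => ⟨le_top, fun x z h _ => (hm.1 x z h).ge, fun y z _ _ h => (hm.2 y z h).ge⟩,
    fun hm => ⟨fun _ _ h => (hm.mid_eq h le_top).symm, fun _ _ h => (hm.low_eq le_top le_top h).symm⟩⟩

lemma ModIn.bot [OrderBot α] (h : α) : ModIn ⊥ h where
  le := bot_le
  mid x z _ _ := by simp
  low y z _ _ _ := by simp

lemma ModIn.inf (hm : ModIn m h) (u : α) : ModIn (m ⊓ u) (h ⊓ u) where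
  le := inf_le_inf_right _ hm.le
  mid x z hxz hz := by
    have hzu : z ≤ u := hz.trans inf_le_right
    calc (x ⊔ m ⊓ u) ⊓ z ≤ (x ⊔ m) ⊓ z := inf_le_inf_right _ (sup_le_sup_left inf_le_left _)
      _ ≤ x ⊔ (m ⊓ z) := hm.mid x z hxz (hz.trans inf_le_left)
      _ = x ⊔ (m ⊓ u ⊓ z) := by rw [inf_assoc, inf_eq_right.2 hzu]
  low y z hy hz hmz := by
    have hzu : z ≤ u := hz.trans inf_le_right
    have hzh : z ≤ h := hz.trans inf_le_left
    have hyh : y ≤ h := hy.trans inf_le_left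
    have hyz : y ⊓ z ≤ h ⊓ u := inf_le_left.trans hy
    -- Only `m ⊓ u ≤ z` is known, so `low` for `m` does not apply to `z`. It is applied to `z ⊔ m`,
    -- from which `z` is recovered by meeting with `h ⊓ u`.
    have h1 : (z ⊔ m) ⊓ (h ⊓ u) = z := by
      rw [hm.mid_eq hz inf_le_left, ← inf_assoc, inf_eq_left.2 hm.le]
      exact sup_eq_left.2 hmz
    have h2 : y ⊓ (z ⊔ m) = y ⊓ z := by
      conv_rhs => rw [← h1]
      rw [← inf_assoc, inf_right_comm, inf_eq_left.2 hy]
    have h3 : m ⊔ (y ⊓ z) = (m ⊔ y) ⊓ (z ⊔ m) := by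
      rw [hm.low_eq hyh (sup_le hzh hm.le) le_sup_right, h2]
    have h4 : (y ⊓ z) ⊔ (m ⊓ (h ⊓ u)) = ((y ⊓ z) ⊔ m) ⊓ (h ⊓ u) :=
      (hm.mid_eq hyz inf_le_left).symm
    rw [← inf_assoc, inf_eq_left.2 hm.le] at h4
    rw [sup_comm (m ⊓ u) (y ⊓ z), h4, sup_comm _ m, h3]
    refine le_inf (le_inf ?_ ?_) (inf_le_right.trans hz)
    · exact inf_le_left.trans (sup_le_sup_right inf_le_left _)
    · exact inf_le_right.trans le_sup_left

lemma ModIn.of_le (hm : ModIn m h) (hmu : m ≤ u) (huh : u ≤ h) : ModIn m u := by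
  simpa [inf_eq_left.2 hmu, inf_eq_right.2 huh] using hm.inf u

lemma ModIn.sup (hm : ModIn m h) (hn : ModIn n h) : ModIn (m ⊔ n) h where
  le := sup_le hm.le hn.le
  low y z hy hz hmz := by
    have h1 : m ≤ z := le_sup_left.trans hmz
    have h2 : n ≤ z := le_sup_right.trans hmz
    rw [sup_assoc, hm.low_eq (sup_le hn.le hy) hz h1, hn.low_eq hy hz h2, sup_assoc]
  mid x z hxz hz := by
    have hxh : x ≤ h := hxz.trans hz
    set s := x ⊔ ((m ⊔ n) ⊓ z) with hs
    have hsz : s ≤ z := sup_le hxz inf_le_right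
    have hms : m ⊓ z ≤ s := (inf_le_inf_right _ le_sup_left).trans le_sup_right
    have hmzh : m ⊔ z ≤ h := sup_le hm.le hz
    -- Modularity of `n` is used with the larger element `m ⊔ z`, so that `x ⊔ m` lies below it;
    -- modularity of `m` then cuts back to `z`.
    have h1 : (x ⊔ m ⊔ n) ⊓ (m ⊔ z) = (x ⊔ m) ⊔ (n ⊓ (m ⊔ z)) :=
      hn.mid_eq (sup_le (hxz.trans le_sup_right) le_sup_left) hmzh
    have h2 : n ⊓ (m ⊔ z) ≤ m ⊔ s := by
      calc n ⊓ (m ⊔ z) ≤ (m ⊔ z) ⊓ (m ⊔ n) := le_inf inf_le_right (inf_le_left.trans le_sup_right)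
        _ = m ⊔ (z ⊓ (m ⊔ n)) := hm.low_eq hz (sup_le hm.le hn.le) le_sup_left
        _ ≤ m ⊔ s := sup_le_sup_left (by rw [inf_comm]; exact le_sup_right) _
    calc (x ⊔ (m ⊔ n)) ⊓ z ≤ ((x ⊔ m ⊔ n) ⊓ (m ⊔ z)) ⊓ z := by
          rw [← sup_assoc]
          exact le_inf (le_inf inf_le_left (inf_le_right.trans le_sup_right)) inf_le_right
      _ ≤ (s ⊔ m) ⊓ z := by
          rw [h1, sup_comm s m]
          exact inf_le_inf_right _ (sup_le (sup_le (le_sup_left.trans le_sup_right) le_sup_left) h2)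
      _ ≤ s ⊔ (m ⊓ z) := hm.mid s z hsz hz
      _ ≤ s := sup_le le_rfl hms

/-- If a proper element `k` above the modular element `m` contains every proper element above `m`,
then `k` is modular as well. -/
lemma ModIn.of_greatest [OrderTop α] {k : α} (hm : ModIn m ⊤) (hmk : m ≤ k)
    (hk : ∀ l, m ≤ l → l ≠ ⊤ → l ≤ k) : ModIn k ⊤ where
  le := le_top
  mid x z hxz _ := by
    by_cases hxm : x ⊔ m = ⊤
    · have := hm.mid x z hxz le_top
      rw [hxm, top_inf_eq] at this
      exact inf_le_right.trans (this.trans (sup_le_sup_left (inf_le_inf_right _ hmk) _))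
    · have : x ≤ k := le_sup_left.trans (hk _ le_sup_right hxm)
      rw [sup_eq_right.2 this]
      exact le_sup_right
  low y z _ _ hkz := by
    by_cases hz : z = ⊤
    · simp [hz]
    · exact inf_le_right.trans ((hk z (hmk.trans hkz) hz).trans le_sup_left)

/-- Each modular identity concerns a comparable pair and is trivial when the two coincide, the lower
one is `⊥` or the upper one is `⊤`. -/
lemma modIn_of_short [BoundedOrder α] (hs : ∀ x z : α, x < z → x = ⊥ ∨ z = ⊤) (m : α) :
    ModIn m ⊤ where
  le := le_top
  mid x z hxz _ := by
    rcases hxz.eq_or_lt with rfl | hlt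
    · exact inf_le_right.trans le_sup_left
    · rcases hs _ _ hlt with rfl | rfl <;> simp
  low y z _ _ hmz := by
    rcases hmz.eq_or_lt with rfl | hlt
    · exact inf_le_right.trans le_sup_left
    · rcases hs _ _ hlt with rfl | rfl <;> simp

end Lattice

/-! ### Modular subgroups under homomorphisms. -/

section Group

variable {G G' : Type*} [Group G] [Group G']

lemma ModIn.comap {f : G →* G'} (hf : Function.Surjective f) {M H : Subgroup G'}
    (hM : ModIn M H) : ModIn (M.comap f) (H.comap f) where
  le := comap_mono hM.le
  mid X Z hXZ hZ := by
    intro z hz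
    have hz2 : z ∈ Z := hz.2
    have h1 : f z ∈ (X.map f ⊔ M) ⊓ Z.map f := by
      refine ⟨?_, mem_map_of_mem f hz2⟩
      have := mem_map_of_mem f hz.1
      rwa [Subgroup.map_sup, map_comap_eq_self_of_surjective hf] at this
    have h2 := hM.mid (X.map f) (Z.map f) (map_mono hXZ) (map_le_iff_le_comap.2 hZ) h1
    have h3 : M ⊓ Z.map f ≤ (M.comap f ⊓ Z).map f := by
      rintro _ ⟨hm, w, hw, rfl⟩
      exact ⟨w, ⟨hm, hw⟩, rfl⟩
    have h4 : f z ∈ (X ⊔ (M.comap f ⊓ Z)).map f := by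
      rw [Subgroup.map_sup]
      exact (sup_le_sup_left h3 _) h2
    obtain ⟨w, hw, hwz⟩ := h4
    have hwZ : w ∈ Z := (sup_le hXZ inf_le_right) hw
    have : z = w * (w⁻¹ * z) := by group
    rw [this]
    refine mul_mem hw ((le_sup_right : M.comap f ⊓ Z ≤ X ⊔ _) ⟨?_, Z.mul_mem (Z.inv_mem hwZ) hz2⟩)
    change f (w⁻¹ * z) ∈ M
    simp [hwz]
  low Y Z hY hZ hMZ := by
    intro z hz
    have hker : f.ker ≤ Z := le_trans (fun x hx => by
      change f x ∈ M; rw [MonoidHom.mem_ker.1 hx]; exact one_mem _) hMZ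
    have hZZ : (Z.map f).comap f = Z := comap_map_eq_self hker
    have hMZ' : M ≤ Z.map f := by
      rw [← map_comap_eq_self_of_surjective hf M]; exact map_mono hMZ
    have h1 : f z ∈ (M ⊔ Y.map f) ⊓ Z.map f := by
      refine ⟨?_, mem_map_of_mem f hz.2⟩
      have := mem_map_of_mem f hz.1
      rwa [Subgroup.map_sup, map_comap_eq_self_of_surjective hf] at this
    have h2 := hM.low (Y.map f) (Z.map f) (map_le_iff_le_comap.2 hY) (map_le_iff_le_comap.2 hZ)
      hMZ' h1
    have h3 : Y.map f ⊓ Z.map f ≤ (Y ⊓ Z).map f := by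
      rintro _ ⟨⟨y, hy, rfl⟩, hyz⟩
      exact ⟨y, ⟨hy, by rw [← hZZ]; exact hyz⟩, rfl⟩
    have h4 : f z ∈ (M.comap f ⊔ (Y ⊓ Z)).map f := by
      rw [Subgroup.map_sup, map_comap_eq_self_of_surjective hf]
      exact (sup_le_sup_left h3 _) h2
    obtain ⟨w, hw, hwz⟩ := h4
    have : z = w * (w⁻¹ * z) := by group
    rw [this]
    refine mul_mem hw ((le_sup_left : M.comap f ≤ _) ?_)
    change f (w⁻¹ * z) ∈ M
    simp [hwz]

lemma ModIn.of_comap {f : G →* G'} (hf : Function.Surjective f) {M H : Subgroup G'}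
    (hM : ModIn (M.comap f) (H.comap f)) : ModIn M H where
  le := (comap_le_comap_of_surjective hf).1 hM.le
  mid X Z hXZ hZ := by
    rw [← comap_le_comap_of_surjective hf, comap_inf, ← comap_sup_eq _ _ _ hf,
      ← comap_sup_eq _ _ _ hf, comap_inf]
    exact hM.mid _ _ (comap_mono hXZ) (comap_mono hZ)
  low Y Z hY hZ hMZ := by
    rw [← comap_le_comap_of_surjective hf, comap_inf, ← comap_sup_eq _ _ _ hf,
      ← comap_sup_eq _ _ _ hf, comap_inf]
    exact hM.low _ _ (comap_mono hY) (comap_mono hZ) (comap_mono hMZ)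

lemma ModIn.map_injective {f : G →* G'} (hf : Function.Injective f) {M H : Subgroup G}
    (hM : ModIn M H) : ModIn (M.map f) (H.map f) where
  le := map_mono hM.le
  mid X Z hXZ hZ := by
    have hr : H.map f ≤ f.range := map_le_range _ _
    have hX : (X.comap f).map f = X := map_comap_eq_self (hXZ.trans (hZ.trans hr))
    have hZ' : (Z.comap f).map f = Z := map_comap_eq_self (hZ.trans hr)
    have := hM.mid (X.comap f) (Z.comap f) (comap_mono hXZ)
      ((comap_mono hZ).trans (comap_map_eq_self_of_injective hf H).le)
    have := map_mono (f := f) this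
    rwa [map_inf_eq _ _ _ hf, Subgroup.map_sup, Subgroup.map_sup, map_inf_eq _ _ _ hf, hX, hZ']
      at this
  low Y Z hY hZ hMZ := by
    have hr : H.map f ≤ f.range := map_le_range _ _
    have hY' : (Y.comap f).map f = Y := map_comap_eq_self (hY.trans hr)
    have hZ' : (Z.comap f).map f = Z := map_comap_eq_self (hZ.trans hr)
    have hc := (comap_map_eq_self_of_injective hf H).le
    have := hM.low (Y.comap f) (Z.comap f) ((comap_mono hY).trans hc) ((comap_mono hZ).trans hc)
      (map_le_iff_le_comap.1 hMZ)
    have := map_mono (f := f) this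
    rwa [map_inf_eq _ _ _ hf, Subgroup.map_sup, Subgroup.map_sup, map_inf_eq _ _ _ hf, hY', hZ']
      at this

lemma ModIn.subgroupOf {M H : Subgroup G} (hM : ModIn M H) : ModIn (M.subgroupOf H) ⊤ where
  le := le_top
  mid X Z hXZ _ := by
    have h := hM.mid (X.map H.subtype) (Z.map H.subtype) (map_mono hXZ) (map_subtype_le _)
    have hM' : (M.subgroupOf H).map H.subtype = M := map_subgroupOf_eq_of_le hM.le
    rw [← map_le_map_iff_of_injective H.subtype_injective, map_inf_eq _ _ _ H.subtype_injective,
      Subgroup.map_sup, Subgroup.map_sup, map_inf_eq _ _ _ H.subtype_injective, hM']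
    exact h
  low Y Z _ _ hMZ := by
    have hM' : (M.subgroupOf H).map H.subtype = M := map_subgroupOf_eq_of_le hM.le
    have h := hM.low (Y.map H.subtype) (Z.map H.subtype) (map_subtype_le _) (map_subtype_le _)
      (by rw [← hM']; exact map_mono hMZ)
    rw [← map_le_map_iff_of_injective H.subtype_injective, map_inf_eq _ _ _ H.subtype_injective,
      Subgroup.map_sup, Subgroup.map_sup, map_inf_eq _ _ _ H.subtype_injective, hM']
    exact h

lemma modIn_iff_isModularSubgroup {M H : Subgroup G} :
    ModIn M H ↔ M ≤ H ∧ IsModularSubgroup (M.subgroupOf H) := by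
  constructor
  · exact fun h => ⟨h.le, isModularElement_iff_modIn.2 h.subgroupOf⟩
  · rintro ⟨hle, h⟩
    have := (isModularElement_iff_modIn.1 h).map_injective H.subtype_injective
    rwa [map_subgroupOf_eq_of_le hle, ← MonoidHom.range_eq_map, range_subtype] at this

lemma modIn_top_of_normal (N : Subgroup G) [N.Normal] : ModIn N ⊤ := by
  have := (ModIn.bot (⊤ : Subgroup (G ⧸ N))).comap (QuotientGroup.mk'_surjective N)
  rwa [MonoidHom.comap_bot, QuotientGroup.ker_mk', comap_top] at this

end Group

/-! ### Chains of modular steps. -/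

/-- Reachability along modular steps. -/
abbrev ModChain {G : Type*} [Group G] (Q H : Subgroup G) : Prop :=
  Relation.ReflTransGen ModIn Q H

lemma ModChain.le {G : Type*} [Group G] {Q H : Subgroup G} (h : ModChain Q H) : Q ≤ H := by
  induction h with
  | refl => exact le_rfl
  | tail _ h ih => exact ih.trans h.le

lemma ModChain.inf {G : Type*} [Group G] {Q H : Subgroup G} (h : ModChain Q H) (U : Subgroup G) :
    ModChain (Q ⊓ U) (H ⊓ U) :=
  h.lift (fun A : Subgroup G => A ⊓ U) fun _ _ h => h.inf U

lemma exists_chain_iff_reflTransGen {α : Type*} (r : α → α → Prop) (a b : α) :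
    (∃ (n : ℕ) (H : ℕ → α), H 0 = a ∧ H n = b ∧ ∀ i < n, r (H i) (H (i + 1))) ↔
      Relation.ReflTransGen r a b := by
  constructor
  · rintro ⟨n, H, rfl, rfl, h⟩
    induction n with
    | zero => exact .refl
    | succ n ih => exact (ih fun i hi => h i (by omega)).tail (h n (by omega))
  · intro h
    induction h with
    | refl => exact ⟨0, fun _ => a, rfl, rfl, by simp⟩
    | @tail b c _ hbc ih =>
      obtain ⟨n, H, h0, hn, h⟩ := ih
      refine ⟨n + 1, fun i => if i ≤ n then H i else c, by simpa using h0, by simp, ?_⟩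
      intro i hi
      rcases Nat.lt_or_eq_of_le (Nat.lt_succ_iff.1 hi) with hlt | rfl
      · simpa [hlt.le, Nat.succ_le_of_lt hlt] using h i hlt
      · simpa [hn] using hbc

lemma isSubmodular_iff_modChain {G : Type*} [Group G] {Q : Subgroup G} :
    IsSubmodular Q ↔ ModChain Q ⊤ := by
  rw [ModChain, ← exists_chain_iff_reflTransGen]
  simp only [IsSubmodular, modIn_iff_isModularSubgroup]

lemma ModIn.of_subgroupOf {G : Type*} [Group G] {M H : Subgroup G} (hle : M ≤ H)
    (h : ModIn (M.subgroupOf H) ⊤) : ModIn M H :=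
  modIn_iff_isModularSubgroup.2 ⟨hle, isModularElement_iff_modIn.2 h⟩

/-! ### Groups of order dividing a product of two primes. -/

lemma relIndex_pos {Y : Type*} [Group Y] [Finite Y] (A B : Subgroup Y) : 0 < A.relIndex B :=
  Nat.pos_of_dvd_of_pos (relIndex_dvd_card A B) Nat.card_pos

/-- Otherwise `⊥ < A < B < ⊤` would write the order as a product of three nontrivial factors, while
a divisor of `p * q` has at most two prime factors with multiplicity. -/
lemma eq_bot_or_eq_top_of_lt {Y : Type*} [Group Y] [Finite Y] {p q : ℕ} (hp : p.Prime)
    (hq : q.Prime) (hY : Nat.card Y ∣ p * q) (A B : Subgroup Y) (hAB : A < B) :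
    A = ⊥ ∨ B = ⊤ := by
  by_contra! h
  have h1 : Nat.card A ≠ 1 := fun h' => h.1 (card_eq_one.1 h')
  have h2 : B.index ≠ 1 := fun h' => h.2 (index_eq_one.1 h')
  have h3 : A.relIndex B ≠ 1 := fun h' => hAB.not_ge (relIndex_eq_one.1 h')
  have h4 : Nat.card A * (A.relIndex B * B.index) = Nat.card Y := by
    rw [relIndex_mul_index hAB.le, card_mul_index]
  have hY0 : Nat.card Y ≠ 0 := Nat.card_pos.ne'
  have hA0 : Nat.card A ≠ 0 := Nat.card_pos.ne'
  have hAB0 : A.relIndex B ≠ 0 := fun h' => by simp [h'] at h4; exact hY0 h4.symm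
  have hB0 : B.index ≠ 0 := fun h' => by simp [h'] at h4; exact hY0 h4.symm
  obtain ⟨d, hd⟩ := hY
  have hd0 : d ≠ 0 := by rintro rfl; simp [hp.ne_zero, hq.ne_zero] at hd
  have := congrArg ArithmeticFunction.cardFactors hd
  rw [ArithmeticFunction.cardFactors_mul hp.ne_zero hq.ne_zero,
    ArithmeticFunction.cardFactors_mul hY0 hd0, ← h4,
    ArithmeticFunction.cardFactors_mul hA0 (mul_ne_zero hAB0 hB0),
    ArithmeticFunction.cardFactors_mul hAB0 hB0,
    ArithmeticFunction.cardFactors_apply_prime hp,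
    ArithmeticFunction.cardFactors_apply_prime hq] at this
  have e1 : ∀ n : ℕ, n ≠ 0 → n ≠ 1 → ArithmeticFunction.cardFactors n ≠ 0 := by
    intro n hn0 hn1 h0
    rcases ArithmeticFunction.cardFactors_eq_zero_iff_eq_zero_or_one.1 h0 with h | h
    exacts [hn0 h, hn1 h]
  have := e1 _ hA0 h1
  have := e1 _ hAB0 h3
  have := e1 _ hB0 h2
  omega

lemma modIn_top_of_index_dvd {W : Type*} [Group W] [Finite W] {p q : ℕ} (hp : p.Prime)
    (hq : q.Prime) {C M : Subgroup W} [C.Normal] (hC : C.index ∣ p * q) (hCM : C ≤ M) :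
    ModIn M ⊤ := by
  have := (modIn_of_short (eq_bot_or_eq_top_of_lt (Y := W ⧸ C) hp hq
    (by rwa [← index_eq_card])) (M.map (QuotientGroup.mk' C))).comap
    (QuotientGroup.mk'_surjective C)
  rwa [comap_top, comap_map_eq_self (by rwa [QuotientGroup.ker_mk'])] at this

lemma card_dvd_of_forall_pow_eq_one {K : Type*} [Group K] [IsCyclic K] {q : ℕ}
    (h : ∀ x : K, x ^ q = 1) : Nat.card K ∣ q := by
  rw [← IsCyclic.exponent_eq_card]
  exact Monoid.exponent_dvd_of_forall_pow_eq_one h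

/-- Let C be the centralizer of N in Q. It is normalized by Q and centralized by N. Since Q/C embeds
in the cyclic group Aut N and is killed by q, its order divides q; so the index of C in QN divides
pq. -/
lemma modIn_sup_of_card_prime {Y : Type*} [Group Y] [Finite Y] {p q : ℕ} (hp : p.Prime)
    (hq : q.Prime) (Q N : Subgroup Y) [N.Normal] (hN : Nat.card N ∣ p)
    (hQ : ∀ g ∈ Q, g ^ q = 1) : ModIn Q (Q ⊔ N) := by
  have := Fact.mk hp
  have hcN : IsCyclic N := isCyclic_of_card_dvd_prime hN
  let φ : Y →* MulAut N := MulAut.conjNormal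
  let C : Subgroup Y := Q ⊓ φ.ker
  have hCQ : C ≤ Q := inf_le_left
  have hcent : ∀ c ∈ C, ∀ n ∈ N, c * n = n * c := by
    intro c hc n hn
    have h1 : φ c = 1 := hc.2
    have h2 : ((φ c ⟨n, hn⟩ : N) : Y) = n := by rw [h1]; rfl
    rw [MulAut.conjNormal_apply] at h2
    exact mul_inv_eq_iff_eq_mul.1 h2
  have hQC : ∀ g ∈ Q, ∀ c ∈ C, g * c * g⁻¹ ∈ C := fun g hg c hc =>
    ⟨Q.mul_mem (Q.mul_mem hg hc.1) (Q.inv_mem hg), (MonoidHom.normal_ker φ).conj_mem c hc.2 g⟩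
  have hnorm : Q ⊔ N ≤ normalizer (C : Set Y) := by
    refine sup_le ?_ ?_
    · rw [← normal_subgroupOf_iff_le_normalizer hCQ, normal_subgroupOf_iff hCQ]
      exact fun c g hc hg => hQC g hg c hc
    · refine le_trans ?_ (centralizer_le_normalizer _)
      intro n hn
      rw [mem_centralizer_iff]
      exact fun c hc => hcent c hc n hn
  have hCn : (C.subgroupOf (Q ⊔ N)).Normal := normal_subgroupOf_of_le_normalizer hnorm
  have hi1 : C.relIndex Q ∣ q := by
    rw [inf_relIndex_left, relIndex_ker]
    have : IsCyclic (MulAut N) := by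
      rcases (Nat.dvd_prime hp).1 hN with h | h
      · have : Subsingleton N := (Nat.card_eq_one_iff_unique.1 h).1
        have : Subsingleton (MulAut N) := ⟨fun a b => MulEquiv.ext fun x => Subsingleton.elim _ _⟩
        infer_instance
      · have e := IsCyclic.mulAutMulEquiv N
        rw [h] at e
        have := ZMod.isCyclic_units_prime hp
        exact isCyclic_of_surjective e.symm e.symm.surjective
    apply card_dvd_of_forall_pow_eq_one
    rintro ⟨_, g, hg, rfl⟩
    ext1
    change φ g ^ q = 1
    rw [← map_pow, hQ g hg, map_one]
  have hi2 : Q.relIndex (Q ⊔ N) ∣ p := by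
    refine dvd_trans ?_ hN
    have e1 : N.relIndex (Q ⊔ N) = N.relIndex Q := relIndex_sup_right Q N
    have e2 := relIndex_mul_relIndex ⊥ N (Q ⊔ N) bot_le le_sup_right
    have e3 := relIndex_mul_relIndex ⊥ Q (Q ⊔ N) bot_le le_sup_left
    have e4 := relIndex_mul_relIndex ⊥ (N ⊓ Q) Q bot_le inf_le_right
    rw [inf_relIndex_right] at e4
    simp only [relIndex_bot_left] at e2 e3 e4
    have h0 : 0 < N.relIndex Q := Nat.pos_of_ne_zero fun h => by
      rw [h, mul_zero] at e4; exact Nat.card_pos.ne e4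
    refine ⟨Nat.card (N ⊓ Q : Subgroup Y), Nat.eq_of_mul_eq_mul_right h0 ?_⟩
    rw [mul_assoc, e4, mul_comm _ (Nat.card Q), e3, ← e1, e2]
  refine ModIn.of_subgroupOf le_sup_left (modIn_top_of_index_dvd hq hp
    (C := C.subgroupOf (Q ⊔ N)) ?_ (comap_mono hCQ))
  change C.relIndex (Q ⊔ N) ∣ q * p
  rw [← relIndex_mul_relIndex C Q (Q ⊔ N) hCQ le_sup_left]
  exact mul_dvd_mul hi1 hi2

/-! ### The residual, and from K-subnormal to submodular. -/

/-- `A ≤ B` are normal subgroups with index one or a prime. -/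
structure NormalPrimeStep {X : Type*} [Group X] (A B : Subgroup X) : Prop where
  le : A ≤ B
  left : A.Normal
  right : B.Normal
  dvd : ∃ p : ℕ, p.Prime ∧ A.relIndex B ∣ p

section

variable {X Y : Type*} [Group X] [Group Y]

/-- The quotient of the intersections embeds in B/A. -/
lemma NormalPrimeStep.inf {A B : Subgroup X} (h : NormalPrimeStep A B) (C : Subgroup X)
    [C.Normal] : NormalPrimeStep (A ⊓ C) (B ⊓ C) := by
  obtain ⟨hle, hA, hB, p, hp, hdvd⟩ := h
  refine ⟨inf_le_inf_right _ hle, inferInstance, inferInstance, p, hp, dvd_trans ?_ hdvd⟩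
  have h1 : (A ⊓ C).relIndex (B ⊓ C) = A.relIndex (B ⊓ C) := by
    rw [← inf_relIndex_right, ← inf_relIndex_right A]
    congr 1
    ext x
    simp only [mem_inf]
    tauto
  rw [h1, ← inf_relIndex_right, ← relIndex_subgroupOf (inf_le_left : B ⊓ C ≤ B),
    ← inf_relIndex_right A B, ← inf_relIndex_right]
  have : (A.subgroupOf B).Normal := inferInstance
  have h2 : ((A ⊓ (B ⊓ C)).subgroupOf B ⊓ (B ⊓ C).subgroupOf B) =
      A.subgroupOf B ⊓ (B ⊓ C).subgroupOf B := by
    ext x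
    simp only [mem_inf, mem_subgroupOf]
    tauto
  rw [h2, inf_relIndex_right, inf_relIndex_right]
  exact relIndex_dvd_index_of_normal _ _

lemma NormalPrimeStep.comap {f : X →* Y} (hf : Function.Surjective f) {A B : Subgroup Y}
    (h : NormalPrimeStep A B) : NormalPrimeStep (A.comap f) (B.comap f) := by
  obtain ⟨hle, hA, hB, p, hp, hdvd⟩ := h
  refine ⟨comap_mono hle, inferInstance, inferInstance, p, hp, ?_⟩
  rwa [relIndex_comap, map_comap_eq_self_of_surjective hf]

lemma reflTransGen_normalPrimeStep_of_isCyclic [Finite X] {A B : Subgroup X} (hA : A.Normal)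
    (hB : B.Normal) (hAB : A ≤ B) (hc : IsCyclic (B ⧸ A.subgroupOf B)) :
    Relation.ReflTransGen NormalPrimeStep A B := by
  induction hn : A.relIndex B using Nat.strong_induction_on generalizing A with
  | _ n ih =>
  by_cases h1 : A.relIndex B = 1
  · rw [le_antisymm hAB (relIndex_eq_one.1 h1)]
  obtain ⟨p, hp, hpd⟩ := Nat.exists_prime_and_dvd h1
  let f : B →* B ⧸ A.subgroupOf B := QuotientGroup.mk' _
  have hcomm : IsMulCommutative (B ⧸ A.subgroupOf B) := IsCyclic.isMulCommutative
  let K : Subgroup (B ⧸ A.subgroupOf B) :=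
    { carrier := {z | z ^ p = 1}
      mul_mem' := fun {a b} ha hb => by
        have : Commute a b := hcomm.is_comm.comm a b
        simp only [Set.mem_ofPred_eq] at *
        rw [this.mul_pow, ha, hb, one_mul]
      one_mem' := one_pow _
      inv_mem' := fun {a} ha => by
        simp only [Set.mem_ofPred_eq] at *
        rw [inv_pow, ha, inv_one] }
  have hKcard : Nat.card K ∣ p := card_dvd_of_forall_pow_eq_one fun x => Subtype.ext x.2
  have hfA : ∀ x : B, f x = 1 ↔ (x : X) ∈ A := fun x => by
    simp [f, QuotientGroup.eq_one_iff, mem_subgroupOf]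
  -- `C` is the preimage of the p-torsion of the cyclic quotient. Being cut out in `B` by a
  -- condition on powers modulo `A`, it is normal in all of `X`.
  set C : Subgroup X := (K.comap f).map B.subtype with hC
  have hmem : ∀ x, x ∈ C ↔ x ∈ B ∧ x ^ p ∈ A := by
    intro x
    constructor
    · rintro ⟨y, hy, rfl⟩
      refine ⟨y.2, ?_⟩
      have : f y ^ p = 1 := hy
      rw [← map_pow, hfA] at this
      exact this
    · rintro ⟨hx, hxp⟩
      refine ⟨⟨x, hx⟩, ?_, rfl⟩
      change f _ ^ p = 1
      rw [← map_pow, hfA]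
      exact hxp
  have hCB : C ≤ B := fun x hx => ((hmem x).1 hx).1
  have hAC : A ≤ C := fun x hx => (hmem x).2 ⟨hAB hx, pow_mem hx p⟩
  have hCn : C.Normal := ⟨fun x hx g => by
    rw [hmem] at hx ⊢
    exact ⟨hB.conj_mem _ hx.1 g, by rw [conj_pow]; exact hA.conj_mem _ hx.2 g⟩⟩
  have hACi : A.relIndex C = Nat.card K := by
    have e := relIndex_map_map_of_injective f.ker (K.comap f) B.subtype_injective
    rwa [relIndex_ker, map_comap_eq_self_of_surjective (QuotientGroup.mk'_surjective _),
      QuotientGroup.ker_mk', map_subgroupOf_eq_of_le hAB] at e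
  have hACne : A.relIndex C ≠ 1 := by
    intro h
    have hp' := Fact.mk hp
    have : p ∣ Nat.card (B ⧸ A.subgroupOf B) := by rwa [← index_eq_card]
    obtain ⟨z, hz⟩ := exists_prime_orderOf_dvd_card' p this
    have hzK : z ∈ K := by change z ^ p = 1; rw [← hz, pow_orderOf_eq_one]
    rw [hACi, card_eq_one] at h
    rw [h, mem_bot] at hzK
    rw [hzK, orderOf_one] at hz
    exact hp.ne_one hz.symm
  have hcy : IsCyclic (B ⧸ C.subgroupOf B) := by
    have hle : A.subgroupOf B ≤ (C.subgroupOf B).comap (MonoidHom.id B) := comap_mono hAC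
    refine isCyclic_of_surjective (QuotientGroup.map _ _ (MonoidHom.id B) hle) ?_
    intro z
    obtain ⟨b, rfl⟩ := QuotientGroup.mk'_surjective _ z
    exact ⟨QuotientGroup.mk' _ b, rfl⟩
  have hmul := relIndex_mul_relIndex A C B hAC hCB
  have hpos : 0 < A.relIndex B := relIndex_pos _ _
  have hlt : C.relIndex B < n := by
    rw [← hn, ← hmul]
    have : 0 < A.relIndex C := relIndex_pos _ _
    have : 0 < C.relIndex B := relIndex_pos _ _
    nlinarith [show 2 ≤ A.relIndex C by omega]
  exact .head ⟨hAC, hA, hCn, p, hp, hACi ▸ hKcard⟩ (ih _ hlt hCn hCB hcy rfl)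

lemma IsSupersolvable.reflTransGen [Finite X] (h : IsSupersolvable X) :
    Relation.ReflTransGen NormalPrimeStep (⊥ : Subgroup X) ⊤ := by
  obtain ⟨n, N, hN, h0, hn, h⟩ := h
  have : ∀ i ≤ n, Relation.ReflTransGen NormalPrimeStep (⊥ : Subgroup X) (N i) := by
    intro i
    induction i with
    | zero => intro _; rw [h0]
    | succ i ih =>
      intro hi
      exact (ih (by omega)).trans (reflTransGen_normalPrimeStep_of_isCyclic (hN i) (hN _)
        (h i (by omega)).1 (h i (by omega)).2)
  exact hn ▸ this n le_rfl

/-- The properties of a normal subgroup with quotient in `U1` that are used for a prime `q`. -/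
structure IsU1Kernel (q : ℕ) (N : Subgroup X) : Prop where
  normal : N.Normal
  chain : Relation.ReflTransGen NormalPrimeStep N ⊤
  pow_mem : ∀ x, x ^ (q ^ 2) ∈ N → x ^ q ∈ N

lemma IsU1Kernel.inf {q : ℕ} {N K : Subgroup X} (hN : IsU1Kernel q N) (hK : IsU1Kernel q K) :
    IsU1Kernel q (N ⊓ K) where
  normal := by have := hN.normal; have := hK.normal; infer_instance
  chain := by
    have := hK.normal
    have h : Relation.ReflTransGen NormalPrimeStep (N ⊓ K) (⊤ ⊓ K) :=
      hN.chain.lift (fun A : Subgroup X => A ⊓ K) fun _ _ h => h.inf K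
    rw [top_inf_eq] at h
    exact h.trans hK.chain
  pow_mem x hx := ⟨hN.pow_mem x hx.1, hK.pow_mem x hx.2⟩

lemma isU1Kernel_of_U1 [Finite X] {q : ℕ} (hq : q.Prime) {N : Subgroup X} (hN : N.Normal)
    (h : U1 (X ⧸ N)) : IsU1Kernel q N where
  normal := hN
  chain := by
    have : Relation.ReflTransGen NormalPrimeStep ((⊥ : Subgroup (X ⧸ N)).comap
        (QuotientGroup.mk' N)) ((⊤ : Subgroup (X ⧸ N)).comap (QuotientGroup.mk' N)) :=
      h.2.1.reflTransGen.lift (fun A => A.comap (QuotientGroup.mk' N)) fun _ _ h =>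
        h.comap (QuotientGroup.mk'_surjective N)
    rwa [MonoidHom.comap_bot, QuotientGroup.ker_mk', comap_top] at this
  pow_mem x hx := by
    have hsq := h.2.2
    set e := Monoid.exponent (X ⧸ N)
    have h1 : orderOf (x : X ⧸ N) ∣ e := Monoid.order_dvd_exponent _
    have h2 : orderOf (x : X ⧸ N) ∣ q ^ 2 := by
      rw [orderOf_dvd_iff_pow_eq_one, ← QuotientGroup.mk_pow, QuotientGroup.eq_one_iff]
      exact hx
    have h3 : orderOf (x : X ⧸ N) ∣ q := by
      obtain ⟨k, hk, hk'⟩ := (Nat.dvd_prime_pow hq).1 h2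
      have : Squarefree (q ^ k) := hk' ▸ hsq.squarefree_of_dvd h1
      rw [hk']
      interval_cases k
      · simp
      · simp
      · have := this q (by rw [sq])
        exact absurd this (by simpa using hq.ne_one)
    rw [orderOf_dvd_iff_pow_eq_one, ← QuotientGroup.mk_pow, QuotientGroup.eq_one_iff] at h3
    exact h3

/-- The residual is a finite intersection of kernels, so only properties stable under intersection
are carried along; membership of the quotient by the residual in `U1` is not needed. -/
lemma isU1Kernel_residual [Finite X] {q : ℕ} (hq : q.Prime) :
    IsU1Kernel q (residual U1 X) := by
  set s : Set (Subgroup X) := {N : Subgroup X | ∃ _ : N.Normal, U1 (X ⧸ N)}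
  have : residual U1 X = s.toFinite.toFinset.inf id := by
    rw [Finset.inf_id_eq_sInf, Set.Finite.coe_toFinset]
    rfl
  rw [this]
  refine Finset.inf_induction ⟨inferInstance, .refl, fun _ _ => mem_top _⟩
    (fun a ha b hb => ha.inf hb) ?_
  intro N hN
  obtain ⟨hn, hU⟩ := (Set.Finite.mem_toFinset _).1 hN
  exact isU1Kernel_of_U1 hq hn hU

lemma pow_mem_of_pow_prime_pow_eq_one {q : ℕ} {R : Subgroup X}
    (hR : ∀ x : X, x ^ (q ^ 2) ∈ R → x ^ q ∈ R) {x : X} {k : ℕ} (hx : x ^ q ^ k = 1) :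
    x ^ q ∈ R := by
  have : ∀ k, x ^ q ^ (k + 1) ∈ R → x ^ q ∈ R := by
    intro k
    induction k with
    | zero => simp
    | succ k ih =>
      intro h
      refine ih ?_
      have := hR (x ^ q ^ k) (by rw [← pow_mul, ← pow_add]; exact h)
      rwa [← pow_mul, ← pow_succ] at this
  exact this k (by rw [pow_succ, pow_mul, hx, one_pow]; exact one_mem _)

/-- Every step `A ≤ B` of the chain above `R` gives a modular step from `Q ⊔ A` to `Q ⊔ B`, seen in
the quotient by `A`, where the image of `Q` is killed by q. -/
lemma IsU1Kernel.modChain [Finite X] {q k : ℕ} (hq : q.Prime) {R Q : Subgroup X}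
    (hR : IsU1Kernel q R) (hQ : Nat.card Q = q ^ k) : ModChain (Q ⊔ R) ⊤ := by
  have hpow : ∀ g ∈ Q, g ^ q ∈ R := fun g hg => by
    refine pow_mem_of_pow_prime_pow_eq_one hR.pow_mem (k := k) ?_
    have := pow_card_eq_one' (x := (⟨g, hg⟩ : Q))
    rw [hQ] at this
    exact congrArg Subtype.val this
  suffices h : ∀ B, Relation.ReflTransGen NormalPrimeStep R B → R ≤ B ∧ ModChain (Q ⊔ R) (Q ⊔ B) by
    have := (h ⊤ hR.chain).2
    rwa [sup_top_eq] at this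
  intro B hB
  induction hB with
  | refl => exact ⟨le_rfl, .refl⟩
  | @tail A B _ hAB ih =>
    refine ⟨ih.1.trans hAB.le, ih.2.tail ?_⟩
    obtain ⟨hle, hA, hB, p, hp, hdvd⟩ := hAB
    let f := QuotientGroup.mk' A
    have hf : Function.Surjective f := QuotientGroup.mk'_surjective A
    have hker : f.ker = A := QuotientGroup.ker_mk' A
    have hBn : (B.map f).Normal := hB.map f hf
    have hcard : Nat.card (B.map f) ∣ p := by
      rwa [← relIndex_ker, hker]
    have h1 := (modIn_sup_of_card_prime hp hq (Q.map f) (B.map f) hcard (by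
      rintro _ ⟨g, hg, rfl⟩
      rw [← map_pow, ← MonoidHom.mem_ker, hker]
      exact ih.1 (hpow g hg))).comap hf
    rwa [comap_map_eq, ← Subgroup.map_sup, comap_map_eq, hker, sup_assoc, sup_eq_left.2 hle] at h1

end

lemma modChain_of_isKSubnormal {G : Type*} [Group G] [Finite G] {Q : Subgroup G} {q k : ℕ}
    (hq : q.Prime) (hQ : Nat.card Q = q ^ k) (h : IsKSubnormal U1 Q) : ModChain Q ⊤ := by
  obtain ⟨n, H, h0, hn, h⟩ := h
  suffices hi : ∀ i ≤ n, ModChain Q (H i) from hn ▸ hi n le_rfl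
  intro i
  induction i with
  | zero => intro _; rw [h0]
  | succ i ih =>
    intro hi
    have hch := ih (by omega)
    obtain ⟨hle, h | h⟩ := h i (by omega)
    · exact hch.tail (ModIn.of_subgroupOf hle (modIn_top_of_normal _))
    · set B := H (i + 1)
      have hQB : Q ≤ B := hch.le.trans hle
      have hcard : Nat.card (Q.subgroupOf B) = q ^ k := by
        rw [← hQ]
        exact Nat.card_congr (subgroupOfEquivOfLe hQB).toEquiv
      have h2 : ModChain ((Q.subgroupOf B ⊔ residual U1 B).map B.subtype)
          ((⊤ : Subgroup B).map B.subtype) :=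
        ((isU1Kernel_residual (X := B) hq).modChain hq hcard).lift (fun A => A.map B.subtype) fun _ _ h => h.map_injective B.subtype_injective
      rw [Subgroup.map_sup, map_subgroupOf_eq_of_le hQB, ← MonoidHom.range_eq_map,
        range_subtype] at h2
      have hR : (residual U1 B).map B.subtype ≤ H i := by
        rw [← map_subgroupOf_eq_of_le hle]
        exact map_mono h
      -- Since `H i` contains the residual and `Q`, intersecting with their join turns the chain
      -- from `Q` to `H i` into one from `Q` to that join.
      have h1 := hch.inf (Q ⊔ (residual U1 B).map B.subtype)
      rw [inf_eq_left.2 le_sup_left, inf_eq_right.2 (sup_le hch.le hR)] at h1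
      exact h1.trans h2

/-! ### Maximal modular subgroups: tools. -/

section

variable {X : Type*} [Group X]

/-- For c strictly between, modularity gives `c = (c ⊔ m) ⊓ h`, yet `c ⊔ m` can only be `m` or `⊤`.
-/
lemma IsCoatom.inf_covBy {α : Type*} [Lattice α] [OrderTop α] {m h : α} (hmax : IsCoatom m)
    (hm : ModIn m ⊤) (hh : ¬ h ≤ m) : m ⊓ h ⋖ h := by
  refine ⟨lt_of_le_not_ge inf_le_right fun hle => hh (hle.trans inf_le_left), fun c hc hch => ?_⟩
  have h1 : (c ⊔ m) ⊓ h = c := by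
    rw [hm.mid_eq hch.le le_top]
    exact sup_eq_left.2 hc.le
  rcases hmax.le_iff.1 (le_sup_right : m ≤ c ⊔ m) with h2 | h2
  · rw [h2, top_inf_eq] at h1
    exact hch.ne h1.symm
  · exact hc.not_ge (le_inf (h2 ▸ le_sup_left) hch.le)

lemma isCoatom_subgroupOf {D M : Subgroup X} (h : D ⋖ M) : IsCoatom (D.subgroupOf M) := by
  refine ⟨fun h' => h.lt.not_ge (subgroupOf_eq_top.1 h'), fun K hK => ?_⟩
  by_contra hne
  have h1 : D < K.map M.subtype := by
    rw [← map_subgroupOf_eq_of_le h.le]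
    exact (map_lt_map_iff_of_injective M.subtype_injective).2 hK
  have h2 : K.map M.subtype < M := by
    refine lt_of_le_of_ne (map_subtype_le _) fun h' => hne ?_
    apply map_injective M.subtype_injective
    rw [h', ← MonoidHom.range_eq_map, range_subtype]
  exact h.2 h1 h2

lemma card_prime_of_forall [Finite X] [Nontrivial X]
    (h : ∀ H : Subgroup X, H = ⊥ ∨ H = ⊤) : (Nat.card X).Prime := by
  obtain ⟨p, hp, hpd⟩ := Nat.exists_prime_and_dvd (Finite.one_lt_card (α := X)).ne'
  have := Fact.mk hp
  obtain ⟨x, hx⟩ := exists_prime_orderOf_dvd_card' p hpd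
  rcases h (zpowers x) with h' | h'
  · rw [zpowers_eq_bot.1 h', orderOf_one] at hx
    exact absurd hx.symm hp.ne_one
  · rwa [← Nat.card_congr (topEquiv (G := X)).toEquiv, ← h', Nat.card_zpowers, hx]

lemma index_prime_of_isCoatom [Finite X] {M : Subgroup X} (hM : IsCoatom M) (hn : M.Normal) :
    M.index.Prime := by
  rw [index_eq_card]
  have hs := QuotientGroup.mk'_surjective M
  have : Nontrivial (X ⧸ M) := by
    rw [← Finite.one_lt_card_iff_nontrivial, ← index_eq_card]
    exact one_lt_index_of_ne_top hM.1
  refine card_prime_of_forall fun H => ?_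
  have hle : M ≤ H.comap (QuotientGroup.mk' M) := by
    have := MonoidHom.ker_le_comap (f := QuotientGroup.mk' M) (H := H)
    rwa [QuotientGroup.ker_mk'] at this
  rcases hM.le_iff.1 hle with h | h
  · right
    exact comap_injective hs (h.trans (comap_top _).symm)
  · left
    apply comap_injective hs
    rw [h, MonoidHom.comap_bot, QuotientGroup.ker_mk']

/-- Two subgroups of order P meeting trivially would give P² distinct products. -/
lemma commute_of_card_lt_sq [Finite X] {P : ℕ} (hP : P.Prime) (hX : Nat.card X < P ^ 2) {x y : X}
    (hx : x ^ P = 1) (hy : y ^ P = 1) : Commute x y := by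
  have := Fact.mk hP
  by_cases hx1 : x = 1
  · rw [hx1]; exact Commute.one_left y
  by_cases hy1 : y = 1
  · rw [hy1]; exact Commute.one_right x
  have cx : Nat.card (zpowers x) = P := by
    rw [Nat.card_zpowers, orderOf_eq_prime hx hx1]
  have cy : Nat.card (zpowers y) = P := by
    rw [Nat.card_zpowers, orderOf_eq_prime hy hy1]
  have hnd : ¬ Disjoint (zpowers x) (zpowers y) := by
    intro hd
    have := Nat.card_le_card_of_injective _ (mul_injective_of_disjoint hd)
    rw [Nat.card_prod, cx, cy, ← sq] at this
    omega
  have hdvd := card_dvd_of_le (inf_le_left : zpowers x ⊓ zpowers y ≤ zpowers x)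
  rw [cx] at hdvd
  rcases (Nat.dvd_prime hP).1 hdvd with h | h
  · exact absurd (disjoint_iff.2 (card_eq_one.1 h)) hnd
  · have h1 : zpowers x ⊓ zpowers y = zpowers x :=
      eq_of_le_of_card_ge inf_le_left (by rw [h, cx])
    have h2 : x ∈ zpowers y := (inf_eq_left.1 h1) (mem_zpowers x)
    obtain ⟨k, rfl⟩ := mem_zpowers_iff.1 h2
    exact (Commute.refl y).zpow_left k

/-- Either `M` is normal, or `M` modulo its core is a subgroup of order `q` and index `p` in a
group of order `p * q`, with primes `q < p`. -/
def NormalOrPrimes (M : Subgroup X) : Prop :=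
  ¬ M.Normal → ∃ p q : ℕ, p.Prime ∧ q.Prime ∧ q < p ∧ M.normalCore.index = p * q ∧ M.index = p

lemma NormalOrPrimes.index_normalCore_lt [Finite X] {M : Subgroup X} (h : NormalOrPrimes M)
    (hM : IsCoatom M) : M.index.Prime ∧ M.normalCore.index < M.index ^ 2 := by
  by_cases hn : M.Normal
  · have := index_prime_of_isCoatom hM hn
    refine ⟨this, ?_⟩
    rw [normalCore_eq_self]
    nlinarith [this.two_le]
  · obtain ⟨p, q, hp, hq, hqp, h1, h2⟩ := h hn
    refine ⟨h2 ▸ hp, ?_⟩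
    rw [h1, h2, sq]
    exact Nat.mul_lt_mul_of_pos_left hqp hp.pos

lemma commutator_mem_of_index_lt [Finite X] {C : Subgroup X} (hC : C.Normal) {P : ℕ}
    (hP : P.Prime) (hX : C.index < P ^ 2) {x y : X} (hx : x ^ P = 1) (hy : y ^ P = 1) :
    x * y * x⁻¹ * y⁻¹ ∈ C := by
  rw [index_eq_card] at hX
  have := commute_of_card_lt_sq hP hX (x := (x : X ⧸ C)) (y := (y : X ⧸ C))
    (by rw [← QuotientGroup.mk_pow, hx]; rfl) (by rw [← QuotientGroup.mk_pow, hy]; rfl)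
  rw [← QuotientGroup.eq_one_iff]
  change (x : X ⧸ C) * y * (x : X ⧸ C)⁻¹ * (y : X ⧸ C)⁻¹ = 1
  rw [this.eq]
  group

lemma exists_subgroup_pow_eq_one (M : Subgroup X) (P : ℕ)
    (h : ∀ x ∈ M, ∀ y ∈ M, x ^ P = 1 → y ^ P = 1 → Commute x y) :
    ∃ T : Subgroup X, ∀ x, x ∈ T ↔ x ∈ M ∧ x ^ P = 1 :=
  ⟨{ carrier := {x | x ∈ M ∧ x ^ P = 1}
     mul_mem' := fun {a b} ha hb => ⟨mul_mem ha.1 hb.1, by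
      rw [(h a ha.1 b hb.1 ha.2 hb.2).mul_pow, ha.2, hb.2, one_mul]⟩
     one_mem' := ⟨one_mem _, one_pow _⟩
     inv_mem' := fun {a} ha => ⟨inv_mem ha.1, by rw [inv_pow, ha.2, inv_one]⟩ },
    fun _ => Iff.rfl⟩

lemma le_normalizer_of_conj_mem {T N : Subgroup X}
    (h : ∀ g ∈ N, ∀ x ∈ T, g * x * g⁻¹ ∈ T) : N ≤ normalizer (T : Set X) := by
  intro g hg
  rw [mem_normalizer_iff]
  refine fun x => ⟨h g hg x, fun hx => ?_⟩
  have := h g⁻¹ (inv_mem hg) _ hx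
  simpa [mul_assoc] using this

/-- The normalizer of T in M contains the maximal subgroup D. If it equals D, then all P-torsion of
M, which centralizes T, lies in D; so T is the whole P-torsion of M and is invariant under M. -/
lemma le_normalizer_pow_eq_one {D M T : Subgroup X} (hD : D ⋖ M) {P : ℕ}
    (h : ∀ x ∈ M, ∀ y ∈ M, x ^ P = 1 → y ^ P = 1 → Commute x y)
    (hT : ∀ x, x ∈ T ↔ x ∈ D ∧ x ^ P = 1) : M ≤ normalizer (T : Set X) := by
  have hDN : D ≤ normalizer (T : Set X) := le_normalizer_of_conj_mem fun g hg x hx => by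
    rw [hT] at hx ⊢
    exact ⟨mul_mem (mul_mem hg hx.1) (inv_mem hg), by rw [conj_pow, hx.2]; simp⟩
  have hsN : ∀ s ∈ M, s ^ P = 1 → s ∈ normalizer (T : Set X) := fun s hs hsP => by
    refine centralizer_le_normalizer _ ?_
    rw [mem_centralizer_iff]
    intro t ht
    have ht := (hT t).1 ht
    exact h t (hD.le ht.1) s hs ht.2 hsP
  rcases hD.eq_or_eq (le_inf hDN hD.le) inf_le_right with h1 | h1
  · refine le_normalizer_of_conj_mem fun g hg x hx => ?_
    rw [hT] at hx ⊢
    have hxP : (g * x * g⁻¹) ^ P = 1 := by rw [conj_pow, hx.2]; simp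
    have hxM : g * x * g⁻¹ ∈ M := mul_mem (mul_mem hg (hD.le hx.1)) (inv_mem hg)
    refine ⟨?_, hxP⟩
    rw [← h1]
    exact ⟨hsN _ hxM hxP, hxM⟩
  · exact inf_eq_right.1 h1

lemma complement_of_isCoatom [Finite X] {S D : Subgroup X} [S.Normal] (hD : IsCoatom D)
    (hSD : S ⊓ D = ⊥) (hS : S ≠ ⊥) :
    D.index = Nat.card S ∧ ∀ x, ∃ s ∈ S, ∃ d ∈ D, x = s * d := by
  have htop : S ⊔ D = ⊤ := by
    rcases hD.le_iff.1 (le_sup_right : D ≤ S ⊔ D) with h | h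
    · exact h
    · exact absurd (inf_eq_left.2 (le_sup_left.trans h.le)) (by rw [hSD]; exact hS.symm)
  have hmul : (S : Set X) * (D : Set X) = Set.univ := by
    rw [← normal_mul, htop, coe_top]
  refine ⟨(isComplement'_of_disjoint_and_mul_eq_univ (disjoint_iff.2 hSD) hmul).index_eq_card,
    fun x => ?_⟩
  have : x ∈ (S : Set X) * (D : Set X) := hmul ▸ Set.mem_univ x
  obtain ⟨s, hs, d, hd, rfl⟩ := Set.mem_mul.1 this
  exact ⟨s, hs, d, hd, rfl⟩

/-- The conjugate `g M g⁻¹`. -/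
def conjSubgroup (g : X) (M : Subgroup X) : Subgroup X :=
  M.comap (MulAut.conj g⁻¹).toMonoidHom

lemma mem_conjSubgroup {g x : X} {M : Subgroup X} : x ∈ conjSubgroup g M ↔ g⁻¹ * x * g ∈ M := by
  simp [conjSubgroup]

lemma surjective_conj (g : X) : Function.Surjective (MulAut.conj g).toMonoidHom :=
  (MulAut.conj g).surjective

lemma ModIn.conjSubgroup {M : Subgroup X} (hM : ModIn M ⊤) (g : X) :
    ModIn (conjSubgroup g M) ⊤ := by
  have := hM.comap (surjective_conj g⁻¹)
  rwa [comap_top] at this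

lemma IsCoatom.conjSubgroup {M : Subgroup X} (hM : IsCoatom M) (g : X) :
    IsCoatom (conjSubgroup g M) :=
  isCoatom_comap_of_surjective (surjective_conj g⁻¹) hM

lemma index_conjSubgroup (g : X) (M : Subgroup X) : (conjSubgroup g M).index = M.index :=
  index_comap_of_surjective _ (surjective_conj g⁻¹)

lemma conjSubgroup_not_le [Finite X] {M : Subgroup X} {g : X}
    (hg : g ∉ normalizer (M : Set X)) :
    ¬ conjSubgroup g M ≤ M ∧ ¬ M ≤ conjSubgroup g M := by
  have key : conjSubgroup g M ≠ M := by
    intro h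
    refine hg ?_
    rw [← inv_mem_iff, mem_normalizer_iff]
    intro x
    conv_lhs => rw [← h, mem_conjSubgroup]
    rw [inv_inv]
  have hi := index_conjSubgroup g M
  have hpos : M.index ≠ 0 := index_ne_zero_of_finite
  constructor
  · intro h
    have := relIndex_mul_index h
    rw [hi] at this
    have h1 : (conjSubgroup g M).relIndex M = 1 :=
      Nat.eq_of_mul_eq_mul_right (Nat.pos_of_ne_zero hpos) (by rw [this, one_mul])
    exact key (le_antisymm h (relIndex_eq_one.1 h1))
  · intro h
    have := relIndex_mul_index h
    rw [hi] at this
    have h1 : M.relIndex (conjSubgroup g M) = 1 :=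
      Nat.eq_of_mul_eq_mul_right (Nat.pos_of_ne_zero hpos) (by rw [this, one_mul])
    exact key (le_antisymm (relIndex_eq_one.1 h1) h)

lemma normalizer_eq_of_isCoatom {M : Subgroup X} (hM : IsCoatom M) (hn : ¬ M.Normal) :
    normalizer (M : Set X) = M := by
  rcases hM.le_iff.1 (le_normalizer (H := M)) with h | h
  · exact absurd (normalizer_eq_top_iff.1 h) hn
  · exact h

lemma normal_of_sup_eq_top {T A B : Subgroup X} (hA : A ≤ normalizer (T : Set X))
    (hB : B ≤ normalizer (T : Set X)) (h : A ⊔ B = ⊤) : T.Normal :=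
  normalizer_eq_top_iff.1 (top_le_iff.1 (h ▸ sup_le hA hB))

lemma mem_normalCore_of_forall {M : Subgroup X} {x : X} (h : ∀ g, x ∈ conjSubgroup g M) :
    x ∈ M.normalCore := fun b => by
  have := mem_conjSubgroup.1 (h b⁻¹)
  rwa [inv_inv] at this

end

/-! ### The order of a core-free maximal modular subgroup. -/

/-- The order of a core-free maximal modular subgroup `M` that is not normal. -/
theorem structure_of_core_free {G : Type v} [Group G] [Finite G]
    (ih : ∀ (X : Type v) [Group X] [Finite X], Nat.card X < Nat.card G →
      ∀ M : Subgroup X, IsCoatom M → ModIn M ⊤ → NormalOrPrimes M)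
    {M : Subgroup G} (hM : IsCoatom M) (hmod : ModIn M ⊤) (hn : ¬ M.Normal)
    (hcore : M.normalCore = ⊥) :
    ∃ P : ℕ, P.Prime ∧ (Nat.card M = P ∨ ∃ q, q.Prime ∧ q < P ∧ Nat.card M = P * q ∧
      ∃ D ≤ M, Nat.card D = q ∧ (∀ x ∈ M, (∀ d ∈ D, x * d * x⁻¹ ∈ D) → x ∈ D) ∧ D ≠ M) := by
  have hMcard : Nat.card M < Nat.card G := by
    refine lt_of_le_of_ne (card_le_card_group M) fun h => hM.1 ?_
    exact card_eq_iff_eq_top M |>.1 h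
  have hnorm := normalizer_eq_of_isCoatom hM hn
  set D : G → Subgroup G := fun g => conjSubgroup g M ⊓ M with hDdef
  have hnle : ∀ g ∉ M, ¬ conjSubgroup g M ≤ M ∧ ¬ M ≤ conjSubgroup g M := fun g hg =>
    conjSubgroup_not_le (by rwa [hnorm])
  have hcov : ∀ g ∉ M, D g ⋖ M := fun g hg =>
    IsCoatom.inf_covBy (IsCoatom.conjSubgroup hM g) (hmod.conjSubgroup g) (hnle g hg).2
  have hcov' : ∀ g ∉ M, D g ⋖ conjSubgroup g M := fun g hg => by
    have := IsCoatom.inf_covBy hM hmod (hnle g hg).1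
    rwa [inf_comm] at this
  have hnp : ∀ g ∉ M, NormalOrPrimes ((D g).subgroupOf M) := fun g hg =>
    ih M hMcard _ (isCoatom_subgroupOf (hcov g hg)) (by
      have := ((hmod.conjSubgroup g).inf M)
      rw [top_inf_eq] at this
      exact this.subgroupOf)
  have hidx := fun g hg => (hnp g hg).index_normalCore_lt (isCoatom_subgroupOf (hcov g hg))
  obtain ⟨g₁, hg₁⟩ : ∃ g, g ∉ M := by
    by_contra! h
    exact hM.1 (eq_top_iff.2 fun x _ => h x)
  -- With the largest index P, the quotient of M by the core of any `D g` has order below P², so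
  -- P-torsion commutes there for all g at once.
  obtain ⟨g₀, hg₀, hmaxi⟩ := Set.exists_max_image {g | g ∉ M} (fun g => (D g).relIndex M)
    (Set.toFinite _) ⟨g₁, hg₁⟩
  set P := (D g₀).relIndex M with hPdef
  have hP : P.Prime := (hidx g₀ hg₀).1
  have hPf := Fact.mk hP
  have hcore1 : ∀ x, (∀ g ∉ M, x ∈ D g) → x = 1 := by
    intro x hx
    have : x ∈ M.normalCore := mem_normalCore_of_forall fun g => by
      by_cases hg : g ∈ M
      · rw [mem_conjSubgroup]
        exact mul_mem (mul_mem (inv_mem hg) (hx g₁ hg₁).2) hg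
      · exact (hx g hg).1
    rwa [hcore, mem_bot] at this
  have hcomm : ∀ x ∈ M, ∀ y ∈ M, x ^ P = 1 → y ^ P = 1 → Commute x y := by
    intro x hx y hy hxP hyP
    have h1 : x * y * x⁻¹ * y⁻¹ = 1 := hcore1 _ fun g hg => by
      have h2 := (hidx g hg).2
      have h3 : (D g).relIndex M ≤ P := hmaxi g hg
      have := commutator_mem_of_index_lt (C := ((D g).subgroupOf M).normalCore) inferInstance hP
        (h2.trans_le (Nat.pow_le_pow_left h3 2)) (x := ⟨x, hx⟩) (y := ⟨y, hy⟩)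
        (Subtype.ext hxP) (Subtype.ext hyP)
      exact normalCore_le ((D g).subgroupOf M) this
    have := mul_inv_eq_one.1 h1
    exact mul_inv_eq_iff_eq_mul.1 this
  have hcomm' : ∀ g, ∀ x ∈ conjSubgroup g M, ∀ y ∈ conjSubgroup g M, x ^ P = 1 → y ^ P = 1 →
      Commute x y := by
    intro g x hx y hy hxP hyP
    have e : ∀ z : G, z ^ P = 1 → (g⁻¹ * z * g) ^ P = 1 := fun z hz => by
      have := conj_pow (a := g⁻¹) (b := z) (i := P)
      rw [inv_inv] at this
      rw [this, hz]; simp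
    have := hcomm _ (mem_conjSubgroup.1 hx) _ (mem_conjSubgroup.1 hy) (e x hxP) (e y hyP)
    have h2 : g * ((g⁻¹ * x * g) * (g⁻¹ * y * g)) * g⁻¹ =
      g * ((g⁻¹ * y * g) * (g⁻¹ * x * g)) * g⁻¹ := by rw [this.eq]
    simpa [mul_assoc, Commute, SemiconjBy] using h2
  -- The P-torsion of `D g` is normalized by `M` and by its conjugate, which generate `G`; so it
  -- lies in the trivial core.
  have hpt : ∀ g ∉ M, ∀ x ∈ D g, x ^ P = 1 → x = 1 := by
    intro g hg x hx hxP
    obtain ⟨T, hT⟩ := exists_subgroup_pow_eq_one (D g) P fun x hx y hy =>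
      hcomm x hx.2 y hy.2
    have hsup : M ⊔ conjSubgroup g M = ⊤ := by
      rcases hM.le_iff.1 (le_sup_left : M ≤ M ⊔ conjSubgroup g M) with h | h
      · exact h
      · exact absurd (le_sup_right.trans h.le) (hnle g hg).1
    have hTn : T.Normal := normal_of_sup_eq_top
      (le_normalizer_pow_eq_one (hcov g hg) hcomm hT)
      (le_normalizer_pow_eq_one (hcov' g hg) (hcomm' g) hT) hsup
    have hTM : T ≤ M.normalCore := normal_le_normalCore.2 fun x hx => ((hT x).1 hx).1.2
    have := hTM ((hT x).2 ⟨hx, hxP⟩)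
    rwa [hcore, mem_bot] at this
  obtain ⟨S', hS'⟩ := exists_subgroup_pow_eq_one (⊤ : Subgroup M) P fun x _ y _ hx hy => by
    have := hcomm x x.2 y y.2 (by exact_mod_cast congrArg Subtype.val hx)
      (by exact_mod_cast congrArg Subtype.val hy)
    exact Subtype.ext this
  have hS : ∀ x : M, x ∈ S' ↔ (x : G) ^ P = 1 := fun x => by
    rw [hS', ← Subtype.coe_inj]
    simp
  have hS'n : S'.Normal := ⟨fun x hx g => by
    rw [hS] at hx ⊢
    push_cast
    rw [conj_pow, hx]; simp⟩
  have hPM : P ∣ Nat.card M := relIndex_dvd_card _ _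
  have hS'ne : S' ≠ ⊥ := by
    obtain ⟨x, hx⟩ := exists_prime_orderOf_dvd_card' P hPM
    intro h
    have hxS : x ∈ S' := by
      rw [hS', ← hx]; exact ⟨mem_top _, pow_orderOf_eq_one x⟩
    rw [h, mem_bot] at hxS
    rw [hxS, orderOf_one] at hx
    exact hP.ne_one hx.symm
  have hSD : ∀ g ∉ M, S' ⊓ (D g).subgroupOf M = ⊥ := fun g hg => by
    rw [eq_bot_iff]
    rintro x ⟨hx, hxD⟩
    exact Subtype.ext (hpt g hg x hxD ((hS x).1 hx))
  have hcompl := fun g hg => complement_of_isCoatom (isCoatom_subgroupOf (hcov g hg)) (hSD g hg)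
    hS'ne
  have hScard : Nat.card S' = P := ((hcompl g₀ hg₀).1).symm
  -- Write x = sd with s in S' and d in `D h`. If x centralizes S', then x ^ P = d ^ P lies in `D
  -- h`; as the order of x is prime to P, so does x, for every h.
  have hfaith : ∀ g ∉ M, ∀ x ∈ D g, (∀ s : M, s ∈ S' → Commute x s) → x = 1 := by
    intro g hg x hx hxS
    refine hcore1 x fun h hh => ?_
    obtain ⟨s, hs, d, hd, hsd⟩ := (hcompl h hh).2 ⟨x, hx.2⟩
    have hsd' : x = (s : G) * d := congrArg Subtype.val hsd
    have hc : Commute (s : G) d := by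
      have h1 := (hxS s hs).eq
      rw [hsd', mul_assoc, mul_right_inj] at h1
      exact h1.symm
    have h2 : x ^ P = (d : G) ^ P := by
      rw [hsd', hc.mul_pow, (hS s).1 hs, one_mul]
    have h3 : x ^ P ∈ D h := h2 ▸ pow_mem (mem_subgroupOf.1 hd) P
    have h4 : (orderOf x).Coprime P := by
      rw [Nat.coprime_comm, hP.coprime_iff_not_dvd]
      intro hdvd
      obtain ⟨m, hm⟩ := hdvd
      have ho : 0 < orderOf x := orderOf_pos x
      have h5 : x ^ m = 1 := hpt g hg _ (pow_mem hx m) (by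
        rw [← pow_mul, mul_comm, ← hm, pow_orderOf_eq_one])
      have h6 := Nat.le_of_dvd (Nat.pos_of_ne_zero (by rintro rfl; omega))
        (orderOf_dvd_of_pow_eq_one h5)
      have := hP.two_le
      have : 0 < m := Nat.pos_of_ne_zero (by rintro rfl; omega)
      nlinarith
    have h7 : x ∈ zpowers (x ^ P) := by
      obtain ⟨m, hm⟩ := exists_pow_eq_self_of_coprime h4.symm
      exact mem_zpowers_iff.2 ⟨m, by rw [zpow_natCast]; exact hm⟩
    exact (zpowers_le.2 h3) h7
  -- Such a K meets the normal subgroup S' trivially, hence centralizes it.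
  have hcent : ∀ K : Subgroup M, K.Normal → K ≤ (D g₀).subgroupOf M → K = ⊥ := by
    intro K hK hKD
    rw [eq_bot_iff]
    intro x hx
    refine Subtype.ext (hfaith g₀ hg₀ x (hKD hx) fun s hs => ?_)
    have hd : Disjoint S' K := disjoint_iff.2 (eq_bot_iff.2
      ((inf_le_inf_left _ hKD).trans (hSD g₀ hg₀).le))
    have := commute_of_normal_of_disjoint S' K hS'n hK hd s x hs hx
    exact congrArg Subtype.val this.symm.eq
  refine ⟨P, hP, ?_⟩
  by_cases hDn : ((D g₀).subgroupOf M).Normal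
  · left
    have := hcent _ hDn le_rfl
    have h1 := (hcompl g₀ hg₀).1
    rw [this, index_bot, hScard] at h1
    exact h1
  · right
    obtain ⟨p, q, hp, hq, hqp, h1, h2⟩ := hnp g₀ hg₀ hDn
    rw [hcent _ inferInstance (normalCore_le _), index_bot] at h1
    have h3 : P = p := h2
    subst h3
    refine ⟨q, hq, hqp, h1, D g₀, inf_le_right, ?_, ?_, (hcov g₀ hg₀).lt.ne⟩
    · have := relIndex_mul_relIndex ⊥ (D g₀) M bot_le inf_le_right
      rw [relIndex_bot_left, relIndex_bot_left, h1, mul_comm] at this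
      exact Nat.eq_of_mul_eq_mul_left hP.pos this
    · intro x hx hxD
      have h4 := normalizer_eq_of_isCoatom (isCoatom_subgroupOf (hcov g₀ hg₀)) hDn
      have h5 : (⟨x, hx⟩ : M) ∈ normalizer (((D g₀).subgroupOf M : Subgroup M) : Set M) := by
        rw [mem_normalizer_iff]
        have hfin : ∀ d : G, x * d * x⁻¹ ∈ D g₀ → d ∈ D g₀ := by
          intro d hd
          have himg : (fun d => x * d * x⁻¹) '' (D g₀ : Set G) = (D g₀ : Set G) := by
            refine Set.eq_of_subset_of_ncard_le ?_ ?_ (Set.toFinite _)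
            · rintro _ ⟨d, hd, rfl⟩
              exact hxD d hd
            · rw [Set.ncard_image_of_injective]
              intro a b hab
              simpa using hab
          have : x * d * x⁻¹ ∈ (fun d => x * d * x⁻¹) '' (D g₀ : Set G) :=
            (Set.ext_iff.1 himg _).2 hd
          obtain ⟨d', hd', he⟩ := this
          have : d' = d := by simpa using he
          exact this ▸ hd'
        exact fun d => ⟨fun hd => hxD d hd, fun hd => hfin d hd⟩
      rw [h4] at h5
      exact h5

/-! ### A normal complement to a core-free maximal modular subgroup. -/

section

variable {G : Type v} [Group G] [Finite G]

lemma normal_of_isCoatom_of_isPGroup {X : Type*} [Group X] [Finite X] {p : ℕ} (hp : p.Prime)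
    (hX : IsPGroup p X) {M : Subgroup X} (hM : IsCoatom M) : M.Normal := by
  have := Fact.mk hp
  have := hX.isNilpotent
  exact NormalizerCondition.normal_of_coatom M Group.normalizerCondition_of_isNilpotent hM

/-- A Sylow subgroup for the smallest prime whose intersection with a maximal modular subgroup is
small and self-normalizing in that subgroup has a normal complement. -/
lemma exists_normal_complement {l : ℕ} (hl : l.Prime) (hmin : (Nat.card G).minFac = l)
    {M : Subgroup G} (hM : IsCoatom M) (hmod : ModIn M ⊤) (Q : Sylow l G)
    (hE : Nat.card (M ⊓ Q : Subgroup G) ∣ l)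
    (hnorm : Nat.card (M ⊓ Q : Subgroup G) = l → ∀ x ∈ M,
      (∀ d ∈ M ⊓ (Q : Subgroup G), x * d * x⁻¹ ∈ M ⊓ (Q : Subgroup G)) → x ∈ (Q : Subgroup G)) :
    ∃ K : Subgroup G, K.Normal ∧ IsComplement' K (Q : Subgroup G) := by
  have := Fact.mk hl
  -- Burnside's normal complement criterion.
  suffices h : normalizer (Q : Set G) ≤ centralizer (Q : Set G) from
    ⟨_, MonoidHom.normal_ker _, MonoidHom.ker_transferSylow_isComplement' Q h⟩
  have hcyc : Nat.card Q ∣ l → normalizer (Q : Set G) ≤ centralizer (Q : Set G) := fun h =>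
    IsCyclic.normalizer_le_centralizer hmin (isCyclic_of_card_dvd_prime h)
  by_cases hQM : (Q : Subgroup G) ≤ M
  · rw [inf_eq_right.2 hQM] at hE
    exact hcyc hE
  have hcov := IsCoatom.inf_covBy hM hmod hQM
  have hco := isCoatom_subgroupOf hcov
  have hidx := index_prime_of_isCoatom hco (normal_of_isCoatom_of_isPGroup hl Q.2 hco)
  have hidx' : (M ⊓ (Q : Subgroup G)).relIndex Q = l := by
    obtain ⟨k, hk⟩ := Q.2.exists_card_eq
    have h1 : (M ⊓ (Q : Subgroup G)).relIndex Q ∣ l ^ k := hk ▸ relIndex_dvd_card _ _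
    exact (Nat.prime_dvd_prime_iff_eq hidx hl).1 (hidx.dvd_of_dvd_pow h1)
  have hcard : Nat.card (M ⊓ Q : Subgroup G) * l = Nat.card Q := by
    have := relIndex_mul_relIndex ⊥ (M ⊓ (Q : Subgroup G)) Q bot_le inf_le_right
    rwa [relIndex_bot_left, relIndex_bot_left, hidx'] at this
  rcases (Nat.dvd_prime hl).1 hE with h1 | h1
  · rw [h1, one_mul] at hcard
    exact hcyc (by rw [← hcard])
  -- Here Q has order l². The part of its normalizer in M also normalizes `M ⊓ Q`, so lies in Q; as
  -- it is maximal in the normalizer and Q is not inside M, Q is self-normalizing, and it is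
  -- abelian.
  · have hQN : (Q : Subgroup G) ≤ normalizer (Q : Set G) := le_normalizer
    have hcovN := IsCoatom.inf_covBy hM hmod (fun h => hQM (hQN.trans h))
    have hle : M ⊓ normalizer (Q : Set G) ≤ Q := by
      rintro x ⟨hxM, hxN⟩
      refine hnorm h1 x hxM fun d hd => ⟨?_, ?_⟩
      · exact M.mul_mem (M.mul_mem hxM hd.1) (M.inv_mem hxM)
      · exact (mem_normalizer_iff.1 hxN d).1 hd.2
    rcases hcovN.eq_or_eq hle hQN with h2 | h2
    · exact absurd (h2.le.trans inf_le_left) hQM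
    · have hcomm := IsPGroup.isMulCommutative_of_card_eq_prime_sq (p := l) (G := Q) (by
        rw [← hcard, h1, sq])
      rw [← h2]
      intro x hx
      rw [mem_centralizer_iff]
      exact fun y hy => congrArg Subtype.val (hcomm.is_comm.comm (⟨y, hy⟩ : Q) ⟨x, hx⟩)

/-- The Sylow subgroup is taken above M if M has order l, above D if q = l, and is arbitrary if l
does not divide the order of M. -/
lemma exists_sylow_of_structure {l p : ℕ} (hl : l.Prime) (hmin : (Nat.card G).minFac = l)
    (hp : p.Prime) {M : Subgroup G}
    (hstr : Nat.card M = p ∨ ∃ q, q.Prime ∧ q < p ∧ Nat.card M = p * q ∧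
      ∃ D ≤ M, Nat.card D = q ∧ (∀ x ∈ M, (∀ d ∈ D, x * d * x⁻¹ ∈ D) → x ∈ D) ∧ D ≠ M) :
    ∃ Q : Sylow l G, Nat.card (M ⊓ Q : Subgroup G) ∣ l ∧
      (Nat.card (M ⊓ Q : Subgroup G) = l → ∀ x ∈ M,
      (∀ d ∈ M ⊓ (Q : Subgroup G), x * d * x⁻¹ ∈ M ⊓ (Q : Subgroup G)) →
        x ∈ (Q : Subgroup G)) := by
  have := Fact.mk hl
  have hpow : ∀ Q : Sylow l G, ∃ k, Nat.card (M ⊓ Q : Subgroup G) = l ^ k := fun Q =>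
    (Q.2.to_le inf_le_right).exists_card_eq
  by_cases hlM : l ∣ Nat.card M
  · rcases hstr with h | ⟨q, hq, hqp, hM, D, hDM, hD, hDn, -⟩
    · rw [h] at hlM
      have hlp := (Nat.prime_dvd_prime_iff_eq hl hp).1 hlM
      have hMp : IsPGroup l M := IsPGroup.of_card (n := 1) (by rw [h, hlp, pow_one])
      obtain ⟨Q, hQ⟩ := hMp.exists_le_sylow
      refine ⟨Q, ?_, fun _ x hx _ => hQ hx⟩
      rw [inf_eq_left.2 hQ, h, hlp]
    · have hlq : l ≤ q := by
        rw [← hmin]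
        exact Nat.minFac_le_of_dvd hq.two_le
          ((Dvd.intro_left p hM.symm).trans (card_subgroup_dvd_card M))
      have hlq : l = q := by
        rw [hM, hl.dvd_mul, Nat.prime_dvd_prime_iff_eq hl hp,
          Nat.prime_dvd_prime_iff_eq hl hq] at hlM
        omega
      subst hlq
      have hDp : IsPGroup l D := IsPGroup.of_card (n := 1) (by rw [hD, pow_one])
      obtain ⟨Q, hQ⟩ := hDp.exists_le_sylow
      have hle : D ≤ M ⊓ Q := le_inf hDM hQ
      have hdvd : Nat.card (M ⊓ Q : Subgroup G) ∣ l := by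
        have h1 : Nat.card (M ⊓ Q : Subgroup G) ∣ p * l := hM ▸ card_dvd_of_le inf_le_left
        obtain ⟨k, hk⟩ := hpow Q
        refine Nat.Coprime.dvd_of_dvd_mul_left ?_ h1
        rw [hk]
        exact Nat.Coprime.pow_left _ ((Nat.coprime_primes hl hp).2 hqp.ne)
      have heq : D = M ⊓ Q := eq_of_le_of_card_ge hle (by
        rw [hD]; exact Nat.le_of_dvd hl.pos hdvd)
      refine ⟨Q, hdvd, fun _ x hx hd => ?_⟩
      rw [← heq] at hd
      exact hQ (hDn x hx hd)
  · obtain ⟨Q⟩ : Nonempty (Sylow l G) := inferInstance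
    obtain ⟨k, hk⟩ := hpow Q
    have h1 : Nat.card (M ⊓ Q : Subgroup G) = 1 := by
      refine Nat.Coprime.eq_one_of_dvd ?_ (card_dvd_of_le (inf_le_left : M ⊓ Q ≤ M))
      rw [hk]
      exact Nat.Coprime.pow_left _ (hl.coprime_iff_not_dvd.2 hlM)
    exact ⟨Q, h1 ▸ one_dvd _, fun h => absurd (h1.symm.trans h).symm hl.ne_one⟩

/-- Let K be the normal l-complement. If M has order p, then K itself meets M trivially. Otherwise
`M ⊓ K` has order p and is a core-free, non-normal maximal modular subgroup of K; by induction K has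
order rp with r > p, and R is its subgroup of order r. -/
lemma exists_normal_disjoint
    (ih : ∀ (X : Type v) [Group X] [Finite X], Nat.card X < Nat.card G →
      ∀ M : Subgroup X, IsCoatom M → ModIn M ⊤ → NormalOrPrimes M)
    {M : Subgroup G} (hM : IsCoatom M) (hmod : ModIn M ⊤) (hn : ¬ M.Normal)
    (hcore : M.normalCore = ⊥) {p : ℕ} (hp : p.Prime)
    (hstr : Nat.card M = p ∨ ∃ q, q.Prime ∧ q < p ∧ Nat.card M = p * q ∧
      ∃ D ≤ M, Nat.card D = q ∧ (∀ x ∈ M, (∀ d ∈ D, x * d * x⁻¹ ∈ D) → x ∈ D) ∧ D ≠ M) :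
    ∃ R : Subgroup G, R.Normal ∧ R ≠ ⊥ ∧ R ⊓ M = ⊥ := by
  have hcardG : Nat.card G ≠ 1 := by
    intro h
    have := (Nat.card_eq_one_iff_unique.1 h).1
    exact hM.1 (Subsingleton.elim _ _)
  obtain ⟨l, hmin⟩ : ∃ l, (Nat.card G).minFac = l := ⟨_, rfl⟩
  have hl : l.Prime := hmin ▸ Nat.minFac_prime hcardG
  have hlG : l ∣ Nat.card G := hmin ▸ Nat.minFac_dvd _
  have := Fact.mk hl
  obtain ⟨Q, hQ1, hQ2⟩ := exists_sylow_of_structure hl hmin hp hstr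
  obtain ⟨K, hK, hKQ⟩ := exists_normal_complement hl hmin hM hmod Q hQ1 hQ2
  have hKM : ¬ K ≤ M := by
    intro h
    have hK' : K = ⊥ := eq_bot_iff.2 (hcore ▸ normal_le_normalCore.2 h)
    rw [hK', isComplement'_bot_left] at hKQ
    have hG : IsPGroup l G := by
      have := Q.2
      rw [hKQ] at this
      exact this.of_equiv topEquiv
    exact hn (normal_of_isCoatom_of_isPGroup hl hG hM)
  have hKbot : K ≠ ⊥ := fun h => hKM (h ▸ bot_le)
  have hsup : M ⊔ K = ⊤ := by
    rcases hM.le_iff.1 (le_sup_left : M ≤ M ⊔ K) with h | h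
    · exact h
    · exact absurd (le_sup_right.trans h.le) hKM
  have hindex : K.index = Nat.card Q := hKQ.symm.index_eq_card
  have hrel : K.relIndex M = Nat.card Q := by
    rw [← relIndex_sup_right, hsup, relIndex_top_right, hindex]
  have hcard : Nat.card (K ⊓ M : Subgroup G) * Nat.card Q = Nat.card M := by
    have := relIndex_mul_relIndex ⊥ (K ⊓ M) M bot_le inf_le_right
    rwa [relIndex_bot_left, relIndex_bot_left, inf_relIndex_right, hrel] at this
  have hlQ : l ∣ Nat.card Q := Q.dvd_card_of_dvd_card hlG
  have hQM : Nat.card Q ∣ Nat.card M := Dvd.intro_left _ hcard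
  rcases hstr with h | ⟨q, hq, hqp, hMc, -⟩
  · refine ⟨K, hK, hKbot, ?_⟩
    rw [h] at hQM
    have h1 : Nat.card Q = p := ((Nat.dvd_prime hp).1 hQM).resolve_left fun h1 =>
      hl.ne_one (Nat.dvd_one.1 (h1 ▸ hlQ))
    rw [h1, h] at hcard
    exact card_eq_one.1 (Nat.eq_of_mul_eq_mul_right hp.pos (hcard.trans (one_mul p).symm))
  have hlq : l ≤ q := by
    rw [← hmin]
    exact Nat.minFac_le_of_dvd hq.two_le
      ((Dvd.intro_left p hMc.symm).trans (card_subgroup_dvd_card M))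
  have hlq : l = q := by
    have := hlQ.trans hQM
    rw [hMc, hl.dvd_mul, Nat.prime_dvd_prime_iff_eq hl hp,
      Nat.prime_dvd_prime_iff_eq hl hq] at this
    omega
  subst hlq
  have hQl : Nat.card Q = l := by
    refine Nat.dvd_antisymm ?_ hlQ
    rw [hMc] at hQM
    refine Nat.Coprime.dvd_of_dvd_mul_left ?_ hQM
    obtain ⟨k, hk⟩ := Q.2.exists_card_eq
    have hk' : Nat.card Q = l ^ k := hk
    rw [hk']
    exact Nat.Coprime.pow_left _ ((Nat.coprime_primes hl hp).2 hqp.ne)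
  have hS : Nat.card (M ⊓ K : Subgroup G) = p := by
    rw [hQl, hMc] at hcard
    rw [inf_comm]
    exact Nat.eq_of_mul_eq_mul_right hl.pos hcard
  have hKcard : Nat.card K < Nat.card G := by
    rw [← card_mul_index K, hindex, hQl]
    exact (Nat.lt_mul_iff_one_lt_right Nat.card_pos).2 hl.one_lt
  have hcov := IsCoatom.inf_covBy hM hmod hKM
  have hco := isCoatom_subgroupOf hcov
  have hSK : Nat.card ((M ⊓ K).subgroupOf K) = p := by
    rw [← hS]
    exact Nat.card_congr (subgroupOfEquivOfLe inf_le_right).toEquiv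
  have hnS : ¬ ((M ⊓ K).subgroupOf K).Normal := by
    intro hN
    have h1 : K ≤ normalizer ((M ⊓ K : Subgroup G) : Set G) :=
      (normal_subgroupOf_iff_le_normalizer inf_le_right).1 hN
    have h2 : M ≤ normalizer ((M ⊓ K : Subgroup G) : Set G) :=
      le_normalizer_of_conj_mem fun g hg x hx =>
        ⟨M.mul_mem (M.mul_mem hg hx.1) (M.inv_mem hg), hK.conj_mem x hx.2 g⟩
    have h3 : (M ⊓ K).Normal := normal_of_sup_eq_top h2 h1 hsup
    have h4 : M ⊓ K = ⊥ := eq_bot_iff.2 (hcore ▸ normal_le_normalCore.2 inf_le_left)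
    rw [h4, card_bot] at hS
    exact hp.ne_one hS.symm
  have hmodK : ModIn ((M ⊓ K).subgroupOf K) ⊤ := by
    have := hmod.inf K
    rw [top_inf_eq] at this
    exact this.subgroupOf
  obtain ⟨r, s, hr, hs, hsr, h1, h2⟩ := ih K hKcard _ hco hmodK hnS
  have hcoreK : ((M ⊓ K).subgroupOf K).normalCore = ⊥ := by
    have hle := normalCore_le ((M ⊓ K).subgroupOf K)
    have hd := card_dvd_of_le hle
    rw [hSK] at hd
    rcases (Nat.dvd_prime hp).1 hd with h | h
    · exact card_eq_one.1 h
    · have := eq_of_le_of_card_ge hle (by rw [h, hSK])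
      exact absurd (this ▸ normalCore_normal _) hnS
  rw [hcoreK, index_bot] at h1
  have hsp : s = p := by
    have := card_mul_index ((M ⊓ K).subgroupOf K)
    rw [hSK, h1, h2, mul_comm r] at this
    exact (Nat.eq_of_mul_eq_mul_right hr.pos this).symm
  obtain ⟨R, hR⟩ := exists_subgroup_pow_eq_one K r fun x hx y hy hxr hyr => by
    have := commute_of_card_lt_sq (X := K) hr (by
      rw [h1, sq]; exact Nat.mul_lt_mul_of_pos_left hsr hr.pos) (x := ⟨x, hx⟩) (y := ⟨y, hy⟩)
      (Subtype.ext hxr) (Subtype.ext hyr)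
    exact congrArg Subtype.val this.eq
  -- Normality in G holds because R is cut out of the normal subgroup K by a power condition.
  refine ⟨R, ⟨fun x hx g => ?_⟩, ?_, ?_⟩
  · rw [hR] at hx ⊢
    exact ⟨hK.conj_mem x hx.1 g, by rw [conj_pow, hx.2]; simp⟩
  · have := Fact.mk hr
    obtain ⟨x, hx⟩ := exists_prime_orderOf_dvd_card' (G := K) r (h1 ▸ dvd_mul_right r s)
    intro h
    have hxR : (x : G) ∈ R := (hR x).2 ⟨x.2, by
      rw [← hx, ← orderOf_coe, pow_orderOf_eq_one]⟩
    rw [h, mem_bot] at hxR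
    rw [← orderOf_coe, hxR, orderOf_one] at hx
    exact hr.ne_one hx.symm
  · rw [eq_bot_iff]
    rintro x ⟨hxR, hxM⟩
    have hxr := (hR x).1 hxR
    have hxp : x ^ p = 1 := by
      have := pow_card_eq_one' (x := (⟨x, hxM, hxr.1⟩ : (M ⊓ K : Subgroup G)))
      rw [hS] at this
      exact congrArg Subtype.val this
    have hd := Nat.dvd_gcd (orderOf_dvd_of_pow_eq_one hxr.2) (orderOf_dvd_of_pow_eq_one hxp)
    rw [(Nat.coprime_primes hr hp).2 (by omega)] at hd
    exact orderOf_eq_one_iff.1 (Nat.dvd_one.1 hd)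

/-- By the covering property the normal subgroup R has no proper nontrivial subgroups, so its order
is prime. The centralizer of R in M is normalized by M and R, hence trivial, and M embeds in the
abelian group Aut R. -/
lemma normalOrPrimes_of_core_free
    (ih : ∀ (X : Type v) [Group X] [Finite X], Nat.card X < Nat.card G →
      ∀ M : Subgroup X, IsCoatom M → ModIn M ⊤ → NormalOrPrimes M)
    {M : Subgroup G} (hM : IsCoatom M) (hmod : ModIn M ⊤)
    (hcore : M.normalCore = ⊥) : NormalOrPrimes M := by
  intro hn
  obtain ⟨p, hp, hstr⟩ := structure_of_core_free ih hM hmod hn hcore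
  obtain ⟨R, hR, hRbot, hRM⟩ := exists_normal_disjoint ih hM hmod hn hcore hp hstr
  have hRnle : ¬ R ≤ M := fun h => hRbot (by rw [← hRM, inf_eq_left.2 h])
  have hsup : M ⊔ R = ⊤ := by
    rcases hM.le_iff.1 (le_sup_left : M ≤ M ⊔ R) with h | h
    · exact h
    · exact absurd (le_sup_right.trans h.le) hRnle
  have hcov := IsCoatom.inf_covBy hM hmod hRnle
  rw [inf_comm, hRM] at hcov
  have hRp : (Nat.card R).Prime := by
    have : Nontrivial R := (nontrivial_iff_ne_bot R).2 hRbot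
    refine card_prime_of_forall fun H => ?_
    rcases hcov.eq_or_eq bot_le (map_subtype_le H) with h | h
    · left
      exact (map_eq_bot_iff_of_injective H R.subtype_injective).1 h
    · right
      apply map_injective R.subtype_injective
      rw [h, ← MonoidHom.range_eq_map, range_subtype]
  have hRc : IsCyclic R := by
    have := Fact.mk hRp
    exact isCyclic_of_card_dvd_prime (p := Nat.card R) dvd_rfl
  let φ : G →* MulAut R := MulAut.conjNormal
  have hφ : ∀ x, x ∈ φ.ker → ∀ y ∈ R, x * y = y * x := by
    intro x hx y hy
    have h1 : φ x = 1 := hx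
    have h2 : ((φ x ⟨y, hy⟩ : R) : G) = y := by rw [h1]; rfl
    rw [MulAut.conjNormal_apply] at h2
    exact mul_inv_eq_iff_eq_mul.1 h2
  have hker : M ⊓ φ.ker = ⊥ := by
    have hN : (M ⊓ φ.ker).Normal := by
      refine normal_of_sup_eq_top (A := M) (B := R) ?_ ?_ hsup
      · exact le_normalizer_of_conj_mem fun g hg x hx =>
          ⟨M.mul_mem (M.mul_mem hg hx.1) (M.inv_mem hg), (MonoidHom.normal_ker φ).conj_mem x hx.2 g⟩
      · refine le_trans ?_ (centralizer_le_normalizer _)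
        intro y hy
        rw [mem_centralizer_iff]
        exact fun x hx => hφ x hx.2 y hy
    exact eq_bot_iff.2 (hcore ▸ normal_le_normalCore.2 inf_le_left)
  let ψ : M →* MulAut R := φ.comp M.subtype
  have hψ : Function.Injective ψ := by
    rw [← MonoidHom.ker_eq_bot_iff, eq_bot_iff]
    intro x hx
    have : (x : G) ∈ M ⊓ φ.ker := ⟨x.2, hx⟩
    rw [hker, mem_bot] at this
    exact Subtype.ext this
  have hcommM : ∀ x y : M, x * y = y * x := by
    intro x y
    apply hψ
    apply (IsCyclic.mulAutMulEquiv R).injective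
    rw [map_mul, map_mul, map_mul, map_mul, mul_comm]
  have hMp : Nat.card M = p := by
    rcases hstr with h | ⟨q, -, -, -, D, hDM, -, hDn, hne⟩
    · exact h
    -- In an abelian M every element normalizes D, against D being proper and self-normalizing.
    · refine absurd (le_antisymm hDM fun x hx => hDn x hx fun d hd => ?_) hne
      have := congrArg Subtype.val (hcommM ⟨x, hx⟩ ⟨d, hDM hd⟩)
      have this : x * d = d * x := this
      rw [this, mul_inv_cancel_right]
      exact hd
  have hdvd : p ∣ Nat.card R - 1 := by
    have h1 := card_dvd_of_injective ψ hψ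
    rwa [hMp, IsCyclic.card_mulAut, Nat.totient_prime hRp] at h1
  have hlt : p < Nat.card R := by
    have := Nat.le_of_dvd (by have := hRp.two_le; omega) hdvd
    have := hRp.two_le
    omega
  have hcompl : IsComplement' R M := by
    refine isComplement'_of_disjoint_and_mul_eq_univ (disjoint_iff.2 hRM) ?_
    rw [← normal_mul, sup_comm, hsup, coe_top]
  have hMi : M.index = Nat.card R := hcompl.index_eq_card
  refine ⟨Nat.card R, p, hRp, hp, hlt, ?_, hMi⟩
  rw [hcore, index_bot, ← card_mul_index M, hMp, hMi, mul_comm]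

end

lemma NormalOrPrimes.comap {X Y : Type*} [Group X] [Group Y] {f : X →* Y}
    (hf : Function.Surjective f) {M : Subgroup Y} (h : NormalOrPrimes M) :
    NormalOrPrimes (M.comap f) := by
  intro hn
  have hcore : (M.comap f).normalCore = M.normalCore.comap f := by
    ext x
    change (∀ b, f (b * x * b⁻¹) ∈ M) ↔ ∀ b, b * f x * b⁻¹ ∈ M
    simp [hf.forall]
  rw [hcore, index_comap_of_surjective _ hf, index_comap_of_surjective _ hf]
  exact h fun hM => hn (hM.comap f)

/-- A maximal subgroup that is modular and not normal has index `p` and is, modulo its core, a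
subgroup of order `q` in a group of order `p * q`, with primes `q < p`. -/
theorem normalOrPrimes_of_isCoatom {G : Type v} [Group G] [Finite G] {M : Subgroup G}
    (hM : IsCoatom M) (hmod : ModIn M ⊤) : NormalOrPrimes M := by
  suffices H : ∀ n : ℕ, ∀ (X : Type v) [Group X] [Finite X], Nat.card X = n →
      ∀ M : Subgroup X, IsCoatom M → ModIn M ⊤ → NormalOrPrimes M from H _ G rfl M hM hmod
  intro n
  induction n using Nat.strong_induction_on with
  | _ n ih =>
  intro X _ _ hX M hM hmod
  have ih' : ∀ (Y : Type v) [Group Y] [Finite Y], Nat.card Y < Nat.card X →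
      ∀ M : Subgroup Y, IsCoatom M → ModIn M ⊤ → NormalOrPrimes M :=
    fun Y _ _ hY => ih _ (hX ▸ hY) Y rfl
  by_cases hcore : M.normalCore = ⊥
  · exact normalOrPrimes_of_core_free ih' hM hmod hcore
  intro hn
  let f : X →* X ⧸ M.normalCore := QuotientGroup.mk' M.normalCore
  have hf : Function.Surjective f := QuotientGroup.mk'_surjective _
  have hker : f.ker = M.normalCore := QuotientGroup.ker_mk' _
  have hcm : (M.map f).comap f = M := comap_map_eq_self (hker.le.trans (normalCore_le M))
  have hlt : Nat.card (X ⧸ M.normalCore) < Nat.card X := by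
    rw [← index_eq_card, ← card_mul_index M.normalCore]
    refine (Nat.lt_mul_iff_one_lt_left (Nat.pos_of_ne_zero index_ne_zero_of_finite)).2 ?_
    exact (one_lt_card_iff_ne_bot _).2 hcore
  have hMf : IsCoatom (M.map f) := by
    refine ⟨fun h => hM.1 ((hcm.symm.trans (congrArg _ h)).trans (comap_top f)), fun K hK => ?_⟩
    apply comap_injective hf
    rw [comap_top]
    exact hM.2 _ (hcm.symm.trans_lt ((comap_lt_comap_of_surjective hf).2 hK))
  have hmodf : ModIn (M.map f) ⊤ := ModIn.of_comap hf (by rwa [hcm, comap_top])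
  have := (ih' _ hlt _ hMf hmodf).comap hf
  rw [hcm] at this
  exact this hn

/-! ### From submodular to K-subnormal. -/

lemma U1_of_card_eq {Y : Type v} [Group Y] {p q : ℕ} (hp : p.Prime) (hq : q.Prime)
    (hqp : q < p) (hY : Nat.card Y = p * q) : U1 Y := by
  have hfin : Finite Y := Nat.finite_of_card_ne_zero (by
    rw [hY]; exact mul_ne_zero hp.ne_zero hq.ne_zero)
  have hpf := Fact.mk hp
  obtain ⟨x, hx⟩ := exists_prime_orderOf_dvd_card' (G := Y) p (hY ▸ dvd_mul_right p q)
  have hcard : Nat.card (zpowers x) = p := by rw [Nat.card_zpowers, hx]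
  have hindex : (zpowers x).index = q := by
    have := card_mul_index (zpowers x)
    rw [hcard, hY] at this
    exact Nat.eq_of_mul_eq_mul_left hp.pos this
  have hmin : (Nat.card Y).minFac = q := by
    have h1 : (Nat.card Y).minFac.Prime := Nat.minFac_prime (by
      rw [hY]; intro h; exact hp.ne_one (Nat.eq_one_of_mul_eq_one_right h))
    have h2 : (Nat.card Y).minFac ≤ q :=
      Nat.minFac_le_of_dvd hq.two_le (hY ▸ dvd_mul_left q p)
    have h3 : (Nat.card Y).minFac ∣ p * q := hY ▸ Nat.minFac_dvd _
    rw [h1.dvd_mul, Nat.prime_dvd_prime_iff_eq h1 hp, Nat.prime_dvd_prime_iff_eq h1 hq] at h3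
    omega
  have hn : (zpowers x).Normal := normal_of_index_eq_minFac_card (by rw [hindex, hmin])
  have h0 : IsCyclic (zpowers x ⧸ (⊥ : Subgroup Y).subgroupOf (zpowers x)) :=
    isCyclic_of_surjective (QuotientGroup.mk' _) (QuotientGroup.mk'_surjective _)
  have h1 : IsCyclic ((⊤ : Subgroup Y) ⧸ (zpowers x).subgroupOf ⊤) := by
    have hqf := Fact.mk hq
    refine isCyclic_of_card_dvd_prime (p := q) ?_
    rw [← index_eq_card]
    exact dvd_of_eq ((relIndex_top_right _).trans hindex)
  let N : ℕ → Subgroup Y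
    | 0 => ⊥
    | 1 => zpowers x
    | _ => ⊤
  have hN : ∀ i, (N i).Normal
    | 0 => inferInstanceAs (⊥ : Subgroup Y).Normal
    | 1 => hn
    | _ + 2 => inferInstanceAs (⊤ : Subgroup Y).Normal
  refine ⟨hfin, ⟨2, N, hN, rfl, rfl, fun i hi => ?_⟩, ?_⟩
  · interval_cases i
    · exact ⟨bot_le, h0⟩
    · exact ⟨le_top, h1⟩
  · refine Squarefree.squarefree_of_dvd (Group.exponent_dvd_nat_card (G := Y)) ?_
    rw [hY, Nat.squarefree_mul ((Nat.coprime_primes hp hq).2 hqp.ne')]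
    exact ⟨hp.prime.squarefree, hq.prime.squarefree⟩

/-- A power of x with exponent prime to p generates `zpowers x`, so it cannot lie in H. -/
lemma zpowers_inf_le {X : Type*} [Group X] {p k : ℕ} (hp : p.Prime) {x : X}
    (hx : x ^ p ^ k = 1) {H : Subgroup X} (hxH : x ∉ H) : zpowers x ⊓ H ≤ zpowers (x ^ p) := by
  rintro y ⟨hy, hyH⟩
  obtain ⟨j, rfl⟩ := mem_zpowers_iff.1 hy
  by_cases hj : (p : ℤ) ∣ j
  · obtain ⟨i, rfl⟩ := hj
    exact mem_zpowers_iff.2 ⟨i, by rw [zpow_mul, zpow_natCast]⟩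
  · exfalso
    have hc : IsCoprime j ((p : ℤ) ^ k) :=
      ((Nat.prime_iff_prime_int.1 hp).coprime_iff_not_dvd.2 hj).symm.pow_right
    obtain ⟨a, b, hab⟩ := hc
    apply hxH
    have h1 : x = (x ^ j) ^ a := by
      conv_lhs => rw [← zpow_one x, ← hab]
      rw [zpow_add, mul_comm a j, zpow_mul, mul_comm b, zpow_mul,
        show x ^ ((p : ℤ) ^ k) = 1 by exact_mod_cast hx, one_zpow, mul_one]
    rw [h1]
    exact H.zpow_mem hyH a

lemma exists_prime_pow_notMem {X : Type*} [Group X] [Finite X] {N : Subgroup X} (hN : N ≠ ⊤) :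
    ∃ p k : ℕ, p.Prime ∧ ∃ x : X, x ∉ N ∧ x ^ p ^ k = 1 := by
  obtain ⟨p, hp, hpd⟩ := Nat.exists_prime_and_dvd (mt index_eq_one.1 hN)
  have := Fact.mk hp
  obtain ⟨P⟩ : Nonempty (Sylow p X) := inferInstance
  have hnle : ¬ (P : Subgroup X) ≤ N := fun h =>
    P.not_dvd_index (hpd.trans (index_dvd_of_le h))
  obtain ⟨x, hxP, hxN⟩ := SetLike.not_le_iff_exists.1 hnle
  obtain ⟨k, hk⟩ := P.2 ⟨x, hxP⟩
  exact ⟨p, k, hp, x, hxN, congrArg Subtype.val hk⟩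

/-- A maximal member of the set of proper modular subgroups is normal or a maximal subgroup. -/
lemma isCoatom_of_maximal_modIn {X : Type*} [Group X] [Finite X] {L : Subgroup X}
    (hL : ModIn L ⊤) (hLtop : L ≠ ⊤) (hmax : ∀ K, ModIn K ⊤ → K ≠ ⊤ → L ≤ K → K = L)
    (hn : ¬ L.Normal) : IsCoatom L := by
  obtain ⟨p, k, hp, x, hxN, hx⟩ := exists_prime_pow_notMem
    (fun h => hn (normalizer_eq_top_iff.1 h) : normalizer (L : Set X) ≠ ⊤)
  have hxL : x ∉ L := fun h => hxN (le_normalizer h)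
  -- The join of L with a conjugate is modular and larger than L, so maximality makes it everything.
  have hsup : L ⊔ conjSubgroup x L = ⊤ := by
    by_contra h
    have := hmax _ (hL.sup (hL.conjSubgroup x)) h le_sup_left
    exact (conjSubgroup_not_le hxN).1 (le_sup_right.trans this.le)
  have htop : L ⊔ zpowers x = ⊤ := by
    rw [eq_top_iff, ← hsup]
    refine sup_le le_sup_left fun y hy => ?_
    have h1 : x ∈ L ⊔ zpowers x := (le_sup_right : zpowers x ≤ _) (mem_zpowers x)
    have h2 : x⁻¹ * y * x ∈ L ⊔ zpowers x :=
      (le_sup_left : L ≤ L ⊔ zpowers x) (mem_conjSubgroup.1 hy)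
    have := mul_mem (mul_mem h1 h2) (inv_mem h1)
    simpa [mul_assoc] using this
  have hpow : zpowers (x ^ p) ≤ zpowers x := zpowers_le.2 (pow_mem (mem_zpowers x) p)
  have hproper : L ⊔ zpowers (x ^ p) ≠ ⊤ := by
    intro h
    have h1 := hL.mid (zpowers (x ^ p)) (zpowers x) hpow le_top
    rw [sup_comm, h, top_inf_eq] at h1
    have h2 : zpowers x ≤ zpowers (x ^ p) := h1.trans (sup_le le_rfl (by
      rw [inf_comm]; exact zpowers_inf_le hp hx hxL))
    have h3 : orderOf (x ^ p) = orderOf x := by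
      rw [← Nat.card_zpowers, ← Nat.card_zpowers, le_antisymm hpow h2]
    have h4 : p ∣ orderOf x := by
      obtain ⟨m, -, hm⟩ := (Nat.dvd_prime_pow hp).1 (orderOf_dvd_of_pow_eq_one hx)
      rcases Nat.eq_zero_or_pos m with rfl | hm0
      · rw [pow_zero, orderOf_eq_one_iff] at hm
        exact absurd (hm ▸ one_mem L) hxL
      · rw [hm]; exact dvd_pow_self p hm0.ne'
    rw [orderOf_pow_of_dvd hp.ne_zero h4] at h3
    exact (Nat.div_lt_self (orderOf_pos x) hp.one_lt).ne h3
  -- A proper K above L omits x, so modularity of L gives K = L ⊔ (⟨x⟩ ⊓ K), and the intersection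
  -- lies in ⟨x ^ p⟩. This greatest proper subgroup above L is itself modular, hence equal to L.
  have hgreat : ∀ K, L ≤ K → K ≠ ⊤ → K ≤ L ⊔ zpowers (x ^ p) := by
    intro K hLK hK
    have hxK : x ∉ K := fun h => hK (eq_top_iff.2 (htop ▸ sup_le hLK (zpowers_le.2 h)))
    have h1 := hL.low (zpowers x) K le_top le_top hLK
    rw [htop, top_inf_eq] at h1
    exact h1.trans (sup_le_sup_left (zpowers_inf_le hp hx hxK) _)
  have heq := hmax _ (hL.of_greatest le_sup_left hgreat) hproper le_sup_left
  refine ⟨hLtop, fun K hK => ?_⟩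
  by_contra h
  exact hK.not_ge ((hgreat K hK.le h).trans heq.le)

lemma exists_le_normal_or_residual_le {X : Type v} [Group X] [Finite X] {A : Subgroup X}
    (hA : ModIn A ⊤) (hAtop : A ≠ ⊤) :
    ∃ L, A ≤ L ∧ L ≠ ⊤ ∧ (L.Normal ∨ residual U1 X ≤ L) := by
  obtain ⟨L, hAL, hL⟩ := (Set.toFinite {K : Subgroup X | ModIn K ⊤ ∧ K ≠ ⊤}).exists_le_maximal
    (a := A) ⟨hA, hAtop⟩
  refine ⟨L, hAL, hL.prop.2, ?_⟩
  by_cases hn : L.Normal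
  · exact .inl hn
  have hco := isCoatom_of_maximal_modIn hL.prop.1 hL.prop.2
    (fun K h1 h2 h3 => le_antisymm (hL.2 ⟨h1, h2⟩ h3) h3) hn
  obtain ⟨p, q, hp, hq, hqp, h1, -⟩ := normalOrPrimes_of_isCoatom hco hL.prop.1 hn
  refine .inr (le_trans (sInf_le ⟨inferInstance, ?_⟩) (normalCore_le L))
  exact U1_of_card_eq hp hq hqp (by rw [← index_eq_card, h1])

/-- One step of a chain witnessing `KF`-subnormality. -/
def KStep (F : GroupClass.{v}) {G : Type v} [Group G] (A B : Subgroup G) : Prop :=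
  A ≤ B ∧ ((A.subgroupOf B).Normal ∨ residual F B ≤ A.subgroupOf B)

/-- The last step runs from some L to B; A remains modular in the smaller group L, so induction on
the order of B applies. -/
lemma ModIn.reflTransGen_kStep {G : Type v} [Group G] [Finite G] {A B : Subgroup G}
    (h : ModIn A B) : Relation.ReflTransGen (KStep U1) A B := by
  induction hn : Nat.card B using Nat.strong_induction_on generalizing B with
  | _ n ih =>
  by_cases hAB : A = B
  · rw [hAB]
  have hne : A.subgroupOf B ≠ ⊤ := fun h' => hAB (le_antisymm h.le (subgroupOf_eq_top.1 h'))
  obtain ⟨L, hAL, hL, hstep⟩ := exists_le_normal_or_residual_le h.subgroupOf hne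
  have hLB : L.map B.subtype ≤ B := map_subtype_le L
  have hLs : (L.map B.subtype).subgroupOf B = L :=
    comap_map_eq_self_of_injective B.subtype_injective L
  have hAL' : A ≤ L.map B.subtype := by
    rw [← map_subgroupOf_eq_of_le h.le]
    exact map_mono hAL
  have hcard : Nat.card (L.map B.subtype) < n := by
    rw [← hn]
    refine lt_of_le_of_ne (card_le_of_le hLB) fun h' => hL ?_
    rw [← hLs, eq_of_le_of_card_ge hLB h'.ge, subgroupOf_self]
  refine (ih _ hcard (h.of_le hAL' hLB) rfl).tail ⟨hLB, ?_⟩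
  rwa [hLs]

lemma isKSubnormal_of_modChain {G : Type v} [Group G] [Finite G] {Q : Subgroup G}
    (h : ModChain Q ⊤) : IsKSubnormal U1 Q := by
  have h1 : ∀ H, ModChain Q H → Relation.ReflTransGen (KStep U1) Q H := by
    intro H hH
    induction hH with
    | refl => exact .refl
    | tail _ h ih => exact ih.trans h.reflTransGen_kStep
  exact (exists_chain_iff_reflTransGen _ _ _).2 (h1 _ h)

end FiniteGroupEmbedding

theorem theorem1 {G : Type*} [Group G] [Finite G] (Q : Subgroup G)
    (hQ : ∃ p k : ℕ, p.Prime ∧ Nat.card Q = p ^ k) :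
    FiniteGroupEmbedding.IsSubmodular Q ↔
      FiniteGroupEmbedding.IsKSubnormal FiniteGroupEmbedding.U1 Q := by
  obtain ⟨p, k, hp, hk⟩ := hQ
  rw [FiniteGroupEmbedding.isSubmodular_iff_modChain]
  exact ⟨FiniteGroupEmbedding.isKSubnormal_of_modChain,
    FiniteGroupEmbedding.modChain_of_isKSubnormal hp hk⟩
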